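/- Let $k\in\frac12\mathbb Z$ with $k\ge \frac52$, let $\Gamma\subset \mathrm{SL}(2,\mathbb Z)$ be a subgroup of finite index, and let $\nu:\Gamma\to\{|u|=1\}$ be a multiplier system of weight $2-k$. Write $j(g,z)=cz+d$ for $g=\left(\begin{smallmatrix}a&b\\c&d\end{smallmatrix}\right)$, take all powers with the principal branch $-\pi<\arg\le\pi$, and for real $\kappa$ put $w_\kappa(g,h)=j(g,hz)^\kappa j(h,z)^\kappa j(gh,z)^{-\kappa}$ (independent of $z$). A multiplier system of weight $\kappa$ satisfies $\nu(\gamma\delta)=w_\kappa(\gamma,\delta)\nu(\gamma)\nu(\delta)$, and $\nu(-I)=e^{-\pi i\kappa}$ if $-I\in\Gamma$. Let $\mathfrak a$ be a cusp of $\Gamma$ with stabilizer $\Gamma_{\mathfrak a}\subset\Gamma$, and let $\sigma_{\mathfrak a}\in\mathrm{SL}(2,\mathbb R)$ be a scaling matrix for it, that is, $\sigma_{\mathfrak a}\infty=\mathfrak a$ and $\pm\sigma_{\mathfrak a}^{-1}\Gamma_{\mathfrak a}\sigma_{\mathfrak a}=\{\pm\left(\begin{smallmatrix}1&n\\0&1\end{smallmatrix}\right):n\in\mathbb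 Z\}$. The cusp is singular for $\nu$ in weight $\kappa$ if the automorphy factor $\nu(\gamma)j(\gamma,z)^{\kappa}$ is trivial on $\Gamma_{\mathfrak a}$, that is, $\nu(\gamma)j(\gamma,z)^\kappa j(\sigma_{\mathfrak a}^{-1},\gamma z)^\kappa=j(\sigma_{\mathfrak a}^{-1},z)^\kappa$ for all $\gamma\in\Gamma_{\mathfrak a}$ and $z\in\mathbb H$. For a singular cusp define $$E_\kappa(\Gamma,\nu,z,\mathfrak a,s)=\sum_{\gamma\in\Gamma_{\mathfrak a}\backslash\Gamma}\overline{\nu}(\gamma)\,\overline{w_\kappa}(\sigma_{\mathfrak a}^{-1},\gamma)\,j(\sigma_{\mathfrak a}^{-1}\gamma,z)^{-\kappa}\,|j(\sigma_{\mathfrak a}^{-1}\gamma,z)|^{-2s},\qquad E_\kappa(\Gamma,\nu,z,\mathfrak a)=E_\kappa(\Gamma,\nu,z,\mathfrak a,0),$$ and the mock Eisenstein series, with $y=\operatorname{Im}z$, $$\mathcal E_{2-k}(\Gamma,\nu,z,\mathfrak a)=\frac{y^{k-1}}{k-1}\,E_{2-k}(\Gamma,\nu,z,\mathfrak a,k-1).$$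 Let $\mathfrak E^{\#}_{2-k}(\Gamma,\nu)$ be the $\mathbb C$-span of the $\mathcal E_{2-k}(\Gamma,\nu,\cdot,\mathfrak a)$ over all cusps $\mathfrak a$ singular for $\nu$ in weight $2-k$, and let $\mathfrak E_k(\Gamma,\overline\nu)$ be the $\mathbb C$-span of the $E_k(\Gamma,\overline\nu,\cdot,\mathfrak a)$ over all cusps $\mathfrak a$ singular for $\overline\nu$ in weight $k$. Then $\mathfrak E^{\#}_{2-k}(\Gamma,\nu)$ is contained in the space $H^!_{2-k}(\Gamma,\nu)$ of harmonic weak Maass forms of manageable growth, i.e. of smooth $f:\mathbb H\to\mathbb C$ such that $j(\gamma,z)^{k-2}f(\gamma z)=\nu(\gamma)f(z)$ for all $\gamma\in\Gamma$, $\Delta_{2-k}f=0$, where $\Delta_\kappa=-y^2(\partial_x^2+\partial_y^2)+i\kappa y(\partial_x+i\partial_y)$, and, for every $\gamma\in\mathrm{SL}(2,\mathbb Z)$, $j(\gamma,z)^{k-2}f(\gamma z)=O(e^{\epsilon y})$ as $y\to\infty$ for some $\epsilon>0$. Moreover the shadow operator $\xi_{2-k}f=2i\,y^{2-k}\,\overline{\partial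 f/\partial\bar z}$ restricts to an isomorphism of vector spaces (conjugate-linear, as $\xi_{2-k}$ is) $$\xi_{2-k}:\ \mathfrak E^{\#}_{2-k}(\Gamma,\nu)\ \xrightarrow{\ \sim\ }\ \mathfrak E_{k}(\Gamma,\overline{\nu}).$$ -/

import Mathlib

open UpperHalfPlane Matrix Matrix.SpecialLinearGroup Complex
open scoped MatrixGroups ComplexConjugate ContDiff

noncomputable section

namespace MockEisenstein

/-! ### Automorphy factors and multiplier systems

The weight `κ` is a real number (half-integral in the theorem), and `j ^ κ` is always formed with
the principal branch `-π < arg ≤ π`. -/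

/-- `j(g, z) = c z + d` for `g = (a b; c d)`. -/
def j (g : SL(2, ℝ)) (z : ℍ) : ℂ := (g 1 0 : ℂ) * (z : ℂ) + (g 1 1 : ℂ)

/-- `w(g, h) = j(g, h z) ^ κ * j(h, z) ^ κ * j(g h, z) ^ (-κ)`. It does not depend on `z`. -/
def w (κ : ℝ) (g h : SL(2, ℝ)) (z : ℍ) : ℂ :=
  j g (h • z) ^ (κ : ℂ) * j h z ^ (κ : ℂ) * j (g * h) z ^ (-κ : ℂ)

/-- `ν` is a (unitary) multiplier system of weight `κ` on `Γ`. If `-I ∈ Γ` it satisfies the usual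
consistency condition `ν(-I) = exp (-π i κ)`, which is `(-1) ^ κ` when `κ` is an integer. -/
structure IsMultiplierSystem (Γ : Subgroup SL(2, ℤ)) (κ : ℝ) (ν : Γ → ℂ) : Prop where
  norm_eq_one : ∀ γ, ‖ν γ‖ = 1
  map_mul : ∀ (γ δ : Γ) (z : ℍ),
    ν (γ * δ) = w κ ((γ : SL(2, ℤ)) : SL(2, ℝ)) ((δ : SL(2, ℤ)) : SL(2, ℝ)) z * (ν γ * ν δ)
  map_neg_one : ∀ h : (-1 : SL(2, ℤ)) ∈ Γ, ν ⟨-1, h⟩ = cexp (-(Real.pi * Complex.I * κ))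

/-- The slash operator `(f | g)(z) = j(g, z) ^ (-κ) f(g z)`. -/
def slash (κ : ℝ) (f : ℍ → ℂ) (g : SL(2, ℝ)) (z : ℍ) : ℂ := j g z ^ (-κ : ℂ) * f (g • z)

/-! ### Harmonic weak Maass forms and the shadow operator -/

/-- `∂f/∂x`. -/
def dx (f : ℍ → ℂ) (z : ℍ) : ℂ := fderiv ℝ (fun u : ℂ => f (ofComplex u)) z 1

/-- `∂f/∂y`. -/
def dy (f : ℍ → ℂ) (z : ℍ) : ℂ := fderiv ℝ (fun u : ℂ => f (ofComplex u)) z Complex.I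

/-- The Wirtinger derivative `∂f/∂z̄`. -/
def dbar (f : ℍ → ℂ) (z : ℍ) : ℂ := (1 / 2) * (dx f z + Complex.I * dy f z)

/-- The shadow operator `ξ_κ f = 2 i y ^ κ * conj (∂f/∂z̄)`. -/
def shadow (κ : ℝ) (f : ℍ → ℂ) (z : ℍ) : ℂ := 2 * Complex.I * ((z.im ^ κ : ℝ) : ℂ) * conj (dbar f z)

/-- The hyperbolic Laplacian
`Δ_κ = -y² (∂²/∂x² + ∂²/∂y²) + i κ y (∂/∂x + i ∂/∂y)`. -/
def laplacian (κ : ℝ) (f : ℍ → ℂ) (z : ℍ) : ℂ :=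
  -(z.im : ℂ) ^ 2 * (dx (dx f) z + dy (dy f) z) + Complex.I * κ * z.im * (dx f z + Complex.I * dy f z)

/-- `f` belongs to `H^!_κ(Γ, ν)`: it is a harmonic weak Maass form of manageable growth, of
weight `κ` and multiplier system `ν`. As `γ` runs over `SL(2, ℤ)`, the growth condition is
imposed at every cusp `γ ∞`. -/
structure IsHarmonicMaassForm (Γ : Subgroup SL(2, ℤ)) (κ : ℝ) (ν : Γ → ℂ) (f : ℍ → ℂ) : Prop where
  smooth : ContDiffOn ℝ ∞ (fun u : ℂ => f (ofComplex u)) {u : ℂ | 0 < u.im}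
  slash_eq : ∀ γ : Γ, slash κ f ((γ : SL(2, ℤ)) : SL(2, ℝ)) = fun z => ν γ * f z
  harmonic : ∀ z, laplacian κ f z = 0
  growth : ∀ γ : SL(2, ℤ), ∃ ε : ℝ, 0 < ε ∧
    slash κ f (γ : SL(2, ℝ)) =O[atImInfty] fun z : ℍ => Real.exp (ε * z.im)

/-! ### Cusps -/

/-- The stabilizer `Γ_𝔞` in `Γ` of a point `𝔞` of `ℝ ∪ {∞}`. -/
def stab (Γ : Subgroup SL(2, ℤ)) (a : OnePoint ℝ) : Subgroup Γ :=
  (MulAction.stabilizer (GL (Fin 2) ℝ) a).comap ((mapGL ℝ).comp Γ.subtype)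

/-- The translation `T^n = (1 n; 0 1)`. -/
def transl (n : ℤ) : SL(2, ℝ) := ((ModularGroup.T ^ n : SL(2, ℤ)) : SL(2, ℝ))

/-- `σ ∈ SL(2, ℝ)` is a scaling matrix for the cusp `𝔞` of `Γ`: `σ ∞ = 𝔞`, and up to signs
`σ⁻¹ Γ_𝔞 σ` is the stabilizer `{± T^n}` of `∞` in `SL(2, ℤ)`. -/
structure IsScaling (Γ : Subgroup SL(2, ℤ)) (a : OnePoint ℝ) (σ : SL(2, ℝ)) : Prop where
  map_infty : (σ : GL (Fin 2) ℝ) • (OnePoint.infty : OnePoint ℝ) = a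
  conj_stab : ∀ g : SL(2, ℝ),
    (∃ γ ∈ stab Γ a, g = σ⁻¹ * ((γ : SL(2, ℤ)) : SL(2, ℝ)) * σ ∨
      g = -(σ⁻¹ * ((γ : SL(2, ℤ)) : SL(2, ℝ)) * σ)) ↔
    ∃ n : ℤ, g = transl n ∨ g = -transl n

/-- The cusp `𝔞` with scaling matrix `σ` is singular for `ν` in weight `κ`: the automorphy factor
`ν(γ) j(γ, z) ^ κ` is trivial on `Γ_𝔞` in the coordinate given by `σ`. For `γ = σ T^n σ⁻¹` the
condition reads `ν(γ) = 1`; for `γ = -I` it is `ν(-I) = exp (-π i κ)`. It is what is needed for the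
sums over `Γ_𝔞 \ Γ` below to make sense. -/
def IsSingular (Γ : Subgroup SL(2, ℤ)) (κ : ℝ) (ν : Γ → ℂ) (a : OnePoint ℝ) (σ : SL(2, ℝ)) : Prop :=
  ∀ γ ∈ stab Γ a, ∀ z : ℍ,
    ν γ * j ((γ : SL(2, ℤ)) : SL(2, ℝ)) z ^ (κ : ℂ) *
      j σ⁻¹ (((γ : SL(2, ℤ)) : SL(2, ℝ)) • z) ^ (κ : ℂ) = j σ⁻¹ z ^ (κ : ℂ)

/-- `𝔞` is a cusp of `Γ`, singular for `ν` in weight `κ`, and `σ` is a scaling matrix for it. -/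
structure IsSingularCusp (Γ : Subgroup SL(2, ℤ)) (κ : ℝ) (ν : Γ → ℂ) (a : OnePoint ℝ)
    (σ : SL(2, ℝ)) : Prop where
  isCusp : IsCusp a (Γ.map (mapGL ℝ))
  isScaling : IsScaling Γ a σ
  isSingular : IsSingular Γ κ ν a σ

/-! ### Eisenstein series -/

/-- The term `ν̄(γ) w̄(σ⁻¹, γ) j(σ⁻¹ γ, z) ^ (-κ)` of the Eisenstein series. -/
def eisTerm {Γ : Subgroup SL(2, ℤ)} (κ : ℝ) (ν : Γ → ℂ) (σ : SL(2, ℝ)) (γ : Γ) (z : ℍ) : ℂ :=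
  conj (ν γ) * conj (w κ σ⁻¹ ((γ : SL(2, ℤ)) : SL(2, ℝ)) z) *
    j (σ⁻¹ * ((γ : SL(2, ℤ)) : SL(2, ℝ))) z ^ (-κ : ℂ)

lemma j_ne_zero (g : SL(2, ℝ)) (z : ℍ) : j g z ≠ 0 :=
  denom_ne_zero (g : GL (Fin 2) ℝ) z

lemma j_mul (g h : SL(2, ℝ)) (z : ℍ) : j (g * h) z = j g (h • z) * j h z := by
  have h1 : ((h • z : ℍ) : ℂ) = ((h 0 0 : ℂ) * z + h 0 1) / j h z := by
    rw [coe_specialLinearGroup_apply]; simp [j]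
  rw [j.eq_1 g, h1, add_mul, mul_assoc, div_mul_cancel₀ _ (j_ne_zero h z)]
  simp [j, Matrix.mul_apply, Fin.sum_univ_two]
  ring

lemma norm_w (κ : ℝ) (g h : SL(2, ℝ)) (z : ℍ) : ‖w κ g h z‖ = 1 := by
  have h1 := norm_pos_iff.2 (j_ne_zero g (h • z))
  have h2 := norm_pos_iff.2 (j_ne_zero h z)
  have e : ∀ {x : ℂ} (_ : x ≠ 0) (t : ℝ), ‖x ^ (t : ℂ)‖ = ‖x‖ ^ t := fun hx t => by
    rw [norm_cpow_of_ne_zero hx]; simp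
  rw [w, norm_mul, norm_mul, e (j_ne_zero _ _), e (j_ne_zero _ _), ← ofReal_neg,
    e (j_ne_zero _ _), j_mul, norm_mul, Real.mul_rpow h1.le h2.le, Real.rpow_neg h1.le,
    Real.rpow_neg h2.le]
  have := (Real.rpow_pos_of_pos h1 κ).ne'
  have := (Real.rpow_pos_of_pos h2 κ).ne'
  field_simp

/-- The term of the Eisenstein series is the inverse of `ν(γ) j(γ, z) ^ κ j(σ⁻¹, γ z) ^ κ`. -/
lemma eisTerm_eq {Γ : Subgroup SL(2, ℤ)} {κ : ℝ} {ν : Γ → ℂ} (hν : IsMultiplierSystem Γ κ ν)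
    (σ : SL(2, ℝ)) (γ : Γ) (z : ℍ) :
    eisTerm κ ν σ γ z = (ν γ * j ((γ : SL(2, ℤ)) : SL(2, ℝ)) z ^ (κ : ℂ) *
      j σ⁻¹ (((γ : SL(2, ℤ)) : SL(2, ℝ)) • z) ^ (κ : ℂ))⁻¹ := by
  rw [eisTerm, ← inv_eq_conj (hν.norm_eq_one γ), ← inv_eq_conj (norm_w _ _ _ _), w, cpow_neg]
  have h : j (σ⁻¹ * ((γ : SL(2, ℤ)) : SL(2, ℝ))) z ^ (κ : ℂ) ≠ 0 := by
    rw [Ne, cpow_eq_zero_iff]; exact fun h => j_ne_zero _ _ h.1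
  field_simp

/-- At a singular cusp the term depends only on the coset `Γ_𝔞 γ`. -/
lemma eisTerm_mul {Γ : Subgroup SL(2, ℤ)} {κ : ℝ} {ν : Γ → ℂ} (hν : IsMultiplierSystem Γ κ ν)
    {a : OnePoint ℝ} {σ : SL(2, ℝ)} (h : IsSingular Γ κ ν a σ) {δ : Γ} (hδ : δ ∈ stab Γ a)
    (γ : Γ) (z : ℍ) : eisTerm κ ν σ (δ * γ) z = eisTerm κ ν σ γ z := by
  rw [eisTerm_eq hν, eisTerm_eq hν, hν.map_mul δ γ z, w, cpow_neg]
  have hn : j (((δ : SL(2, ℤ)) : SL(2, ℝ)) * ((γ : SL(2, ℤ)) : SL(2, ℝ))) z ^ (κ : ℂ) ≠ 0 := by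
    rw [Ne, cpow_eq_zero_iff]; exact fun h => j_ne_zero _ _ h.1
  have hs := h δ hδ (((γ : SL(2, ℤ)) : SL(2, ℝ)) • z)
  simp only [Subgroup.coe_mul, map_mul, mul_smul]
  rw [← hs]
  field_simp

/-- The set `Γ_𝔞 \ Γ`. -/
abbrev Cosets (Γ : Subgroup SL(2, ℤ)) (a : OnePoint ℝ) : Type :=
  Quotient (QuotientGroup.rightRel (stab Γ a))

/-- The holomorphic Eisenstein series `E_κ(Γ, ν, z, 𝔞)`, formed with the scaling matrix `σ`. -/
def eisensteinSeries (Γ : Subgroup SL(2, ℤ)) (κ : ℝ) (ν : Γ → ℂ) (a : OnePoint ℝ) (σ : SL(2, ℝ))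
    (z : ℍ) : ℂ :=
  ∑' q : Cosets Γ a, eisTerm κ ν σ q.out z

/-- The nonholomorphic Eisenstein series `E_κ(Γ, ν, z, 𝔞, s)`. -/
def nonholEisensteinSeries (Γ : Subgroup SL(2, ℤ)) (κ : ℝ) (ν : Γ → ℂ) (a : OnePoint ℝ)
    (σ : SL(2, ℝ)) (s : ℂ) (z : ℍ) : ℂ :=
  ∑' q : Cosets Γ a, eisTerm κ ν σ q.out z *
    (‖j (σ⁻¹ * ((q.out : SL(2, ℤ)) : SL(2, ℝ))) z‖ : ℂ) ^ (-2 * s)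

/-- The mock Eisenstein series
`𝓔_{2-k}(Γ, ν, z, 𝔞) = y ^ (k-1) / (k-1) * E_{2-k}(Γ, ν, z, 𝔞, k-1)`. -/
def mockEisensteinSeries (Γ : Subgroup SL(2, ℤ)) (k : ℝ) (ν : Γ → ℂ) (a : OnePoint ℝ)
    (σ : SL(2, ℝ)) (z : ℍ) : ℂ :=
  ((z.im ^ (k - 1) / (k - 1) : ℝ) : ℂ) * nonholEisensteinSeries Γ (2 - k) ν a σ ((k - 1 : ℝ) : ℂ) z

/-- The Eisenstein space `𝔈_k(Γ, ν)`: the span of the Eisenstein series of weight `k` at all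
singular cusps. Changing the scaling matrix or passing to an equivalent cusp only multiplies the
series by a nonzero constant. -/
def eisensteinSpace (Γ : Subgroup SL(2, ℤ)) (k : ℝ) (ν : Γ → ℂ) : Submodule ℂ (ℍ → ℂ) :=
  Submodule.span ℂ {f | ∃ a σ, IsSingularCusp Γ k ν a σ ∧ f = eisensteinSeries Γ k ν a σ}

/-- The space `𝔈^#_{2-k}(Γ, ν)`: the span of the mock Eisenstein series of weight `2 - k` at all
singular cusps. -/
def mockEisensteinSpace (Γ : Subgroup SL(2, ℤ)) (k : ℝ) (ν : Γ → ℂ) : Submodule ℂ (ℍ → ℂ) :=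
  Submodule.span ℂ {f | ∃ a σ, IsSingularCusp Γ (2 - k) ν a σ ∧ f = mockEisensteinSeries Γ k ν a σ}

end MockEisenstein

end

/-! Put J = j(σ⁻¹γ, z). Since J ^ (k-2) |J| ^ (2-2k) = J⁻¹ conj(J ^ (1-k)), a mock Eisenstein series
is y ^ (k-1) / (k-1) times a sum of unimodular constants times J⁻¹ conj(J ^ (1-k)). Up to a real
scalar attached to the cusp, J is c z + d with (c, d) the bottom row of an integral matrix, and
distinct cosets give distinct rows. So k > 2 gives absolute, locally uniform convergence and
termwise differentiation. The identity conj J + 2icy = J turns the z̄-derivative into (i/2) y ^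
(k-2) ∑ α conj(J ^ (-k)) (`dbar_weightedSum`). Hence the shadow is the weight k series for conj ν at
the same cusp (`shadow_mockEisensteinSeries`), and harmonicity follows because that sum is
antiholomorphic. Modularity is a reindexing of cosets, and the same comparison of rows bounds growth
at every cusp by y ^ (k-1).

Surjectivity is then immediate on generators, as singularity for ν in weight 2-k and for conj ν in
weight k agree. Injectivity needs neither Fourier expansions nor a choice of inequivalent cusps. In
a vanishing combination of the weight k series, group the terms by direction, the row (c, d) up to a
real scalar. Letting z tend to the cusp -d/c isolates one direction, so the total of each direction
vanishes (`tsum_direction_eq_zero`). A mock term is, apart from the common power of y, the conjugate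
of the weight k term times conj J / J, and this quotient depends only on the direction. So the mock
combination vanishes too (`tsum_conj_mul_div_eq_zero`, `sum_mockEisensteinSeries_eq_zero`). -/

noncomputable section

namespace MockEisenstein

open Filter Topology

/-! ### Sums of powers of affine functions and their conjugates -/

section PowSum

variable {ι : Type*}

/-- The function `α (c u + d) ^ s * conj ((c u + d) ^ t)`. -/
def powTerm (α : ι → ℂ) (c d : ι → ℝ) (s t : ℝ) (i : ι) (u : ℂ) : ℂ :=
  α i * ((c i * u + d i) ^ (s : ℂ) * conj ((c i * u + d i) ^ (t : ℂ)))

/-- The sum of the functions `powTerm`. -/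
def powSum (α : ι → ℂ) (c d : ι → ℝ) (s t : ℝ) (u : ℂ) : ℂ := ∑' i, powTerm α c d s t i u

/-- Locally uniform absolute summability of `α (c u + d) ^ q` on the upper half-plane. -/
def LocallySummable (α : ι → ℂ) (c d : ι → ℝ) (q : ℝ) : Prop :=
  ∀ z : ℂ, 0 < z.im → ∃ b : ι → ℝ, Summable b ∧
    ∀ᶠ u in 𝓝 z, ∀ i, ‖α i‖ * ‖(c i * u + d i : ℂ)‖ ^ q ≤ b i

lemma affine_ne_zero {c d : ℝ} (h : c ≠ 0 ∨ d ≠ 0) {u : ℂ} (hu : 0 < u.im) :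
    (c * u + d : ℂ) ≠ 0 := by
  intro h0
  have h1 := congrArg Complex.im h0
  have h2 := congrArg Complex.re h0
  simp at h1 h2
  have hc : c = 0 := h1.resolve_right hu.ne'
  subst hc
  simp at h2
  simp [h2] at h

/-- For c ≠ 0 the affine function is never real on the half-plane, so it avoids the branch cut. For
c = 0 it may lie on the cut, but it is constant. -/
lemma hasDerivAt_affine_cpow {c d : ℝ} (h : c ≠ 0 ∨ d ≠ 0) {u : ℂ} (hu : 0 < u.im) (s : ℝ) :
    HasDerivAt (fun u : ℂ => (c * u + d : ℂ) ^ (s : ℂ))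
      (s * c * (c * u + d) ^ ((s - 1 : ℝ) : ℂ)) u := by
  by_cases hc : c = 0
  · subst hc
    simpa using hasDerivAt_const u ((d : ℂ) ^ (s : ℂ))
  · have hs : (c * u + d : ℂ) ∈ slitPlane := by
      right
      simpa using ⟨hc, hu.ne'⟩
    have h1 : HasDerivAt (fun u : ℂ => (c * u + d : ℂ)) c u := by
      simpa using ((hasDerivAt_id u).const_mul (c : ℂ)).add_const (d : ℂ)
    convert h1.cpow_const (c := (s : ℂ)) hs using 1
    push_cast
    ring

/-- Wirtinger form of the differential: the coefficients of the identity and of conjugation are ∂/∂z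
and ∂/∂z̄. Both are again of the form `powTerm`, which lets smoothness be proved by induction. -/
lemma hasFDerivAt_powTerm {α : ι → ℂ} {c d : ι → ℝ} {i : ι} (h : c i ≠ 0 ∨ d i ≠ 0) (s t : ℝ)
    {u : ℂ} (hu : 0 < u.im) :
    HasFDerivAt (powTerm α c d s t i)
      (powTerm (fun i => s * α i * c i) c d (s - 1) t i u • (ContinuousLinearMap.id ℝ ℂ) +
        powTerm (fun i => t * α i * c i) c d s (t - 1) i u • (conjCLE : ℂ →L[ℝ] ℂ)) u := by
  have h1 := (hasDerivAt_affine_cpow h hu s).hasFDerivAt.restrictScalars ℝ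
  have h2 := (hasDerivAt_affine_cpow h hu t).hasFDerivAt.restrictScalars ℝ
  have h3 := (conjCLE : ℂ →L[ℝ] ℂ).hasFDerivAt.comp u h2
  refine ((h1.mul h3).const_mul (α i)).congr_fderiv ?_
  ext
  all_goals simp [powTerm]; ring

lemma norm_powTerm {α : ι → ℂ} {c d : ι → ℝ} {i : ι} (h : c i ≠ 0 ∨ d i ≠ 0) (s t : ℝ)
    {u : ℂ} (hu : 0 < u.im) :
    ‖powTerm α c d s t i u‖ = ‖α i‖ * ‖(c i * u + d i : ℂ)‖ ^ (s + t) := by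
  have h0 := affine_ne_zero h hu
  rw [powTerm, norm_mul, norm_mul, RCLike.norm_conj, norm_cpow_of_ne_zero h0,
    norm_cpow_of_ne_zero h0, Real.rpow_add (norm_pos_iff.2 h0)]
  simp

lemma abs_mul_im_le_norm_affine (c d : ℝ) {u : ℂ} (hu : 0 < u.im) :
    |c| * u.im ≤ ‖(c * u + d : ℂ)‖ := by
  have := Complex.abs_im_le_norm (c * u + d : ℂ)
  simpa [abs_mul, abs_of_pos hu] using this

/-- Differentiation brings out a factor c and lowers the exponent by one; |c| Im u ≤ |cu + d| pays
for both. -/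
lemma LocallySummable.deriv {α : ι → ℂ} {c d : ι → ℝ} {q : ℝ} (h0 : ∀ i, c i ≠ 0 ∨ d i ≠ 0)
    (H : LocallySummable α c d q) (s : ℝ) :
    LocallySummable (fun i => s * α i * c i) c d (q - 1) := by
  intro z hz
  obtain ⟨b, hb, hbu⟩ := H z hz
  refine ⟨fun i => |s| * (z.im / 2)⁻¹ * b i, hb.mul_left _, ?_⟩
  filter_upwards [hbu, (continuous_im.tendsto z).eventually (lt_mem_nhds (half_lt_self hz))]
    with u hu hu2 i
  have hu0 : 0 < u.im := (half_pos hz).trans hu2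
  have hJ := norm_pos_iff.2 (affine_ne_zero (h0 i) hu0)
  rw [Real.rpow_sub_one hJ.ne']
  have h3 : |c i| / ‖(c i * u + d i : ℂ)‖ ≤ (z.im / 2)⁻¹ := by
    rw [div_le_iff₀ hJ, ← div_eq_inv_mul, le_div_iff₀ (half_pos hz)]
    exact (mul_le_mul_of_nonneg_left hu2.le (abs_nonneg _)).trans
      (abs_mul_im_le_norm_affine _ _ hu0)
  calc ‖s * α i * c i‖ * (‖(c i * u + d i : ℂ)‖ ^ q / ‖(c i * u + d i : ℂ)‖)
      = |s| * (|c i| / ‖(c i * u + d i : ℂ)‖) * (‖α i‖ * ‖(c i * u + d i : ℂ)‖ ^ q) := by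
        simp only [norm_mul, norm_real, Real.norm_eq_abs]; ring
    _ ≤ |s| * (z.im / 2)⁻¹ * b i := by
        gcongr
        exact hu i

lemma LocallySummable.summable_norm {α : ι → ℂ} {c d : ι → ℝ} {q : ℝ}
    (H : LocallySummable α c d q) {z : ℂ} (hz : 0 < z.im) :
    Summable fun i => ‖α i‖ * ‖(c i * z + d i : ℂ)‖ ^ q := by
  obtain ⟨b, hb, hbu⟩ := H z hz
  exact hb.of_nonneg_of_le (fun i => by positivity) hbu.self_of_nhds

lemma LocallySummable.summable {α : ι → ℂ} {c d : ι → ℝ} {q s t : ℝ}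
    (h0 : ∀ i, c i ≠ 0 ∨ d i ≠ 0) (H : LocallySummable α c d q) (hq : s + t = q) {z : ℂ}
    (hz : 0 < z.im) : Summable fun i => powTerm α c d s t i z := by
  refine Summable.of_norm ?_
  simp_rw [fun i => norm_powTerm (α := α) (h0 i) s t hz, hq]
  exact H.summable_norm hz

lemma hasFDerivAt_powSum {α : ι → ℂ} {c d : ι → ℝ} {q s t : ℝ}
    (h0 : ∀ i, c i ≠ 0 ∨ d i ≠ 0) (H : LocallySummable α c d q) (hq : s + t = q) {z : ℂ}
    (hz : 0 < z.im) :
    HasFDerivAt (powSum α c d s t)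
      (powSum (fun i => s * α i * c i) c d (s - 1) t z • (ContinuousLinearMap.id ℝ ℂ) +
        powSum (fun i => t * α i * c i) c d s (t - 1) z • (conjCLE : ℂ →L[ℝ] ℂ)) z := by
  have H1 := H.deriv h0 s
  have H2 := H.deriv h0 t
  obtain ⟨b1, hb1, hu1⟩ := H1 z hz
  obtain ⟨b2, hb2, hu2⟩ := H2 z hz
  have hpos : ∀ᶠ u : ℂ in 𝓝 z, 0 < u.im := (continuous_im.tendsto z).eventually (lt_mem_nhds hz)
  obtain ⟨ε, hε, hball⟩ := Metric.eventually_nhds_iff_ball.1 ((hu1.and hu2).and hpos)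
  have key := hasFDerivAt_tsum_of_isPreconnected (𝕜 := ℝ) (hb1.add hb2) Metric.isOpen_ball
    (convex_ball z ε).isPreconnected (f := fun i => powTerm α c d s t i)
    (fun i u hu => hasFDerivAt_powTerm (h0 i) s t (hball u hu).2) ?_ (Metric.mem_ball_self hε)
    (H.summable h0 hq hz) (Metric.mem_ball_self hε)
  · refine key.congr_fderiv ?_
    have S1 := H1.summable h0 (show (s - 1) + t = q - 1 by rw [← hq]; ring) hz
    have S2 := H2.summable h0 (show s + (t - 1) = q - 1 by rw [← hq]; ring) hz
    rw [Summable.tsum_add (S1.smul_const _) (S2.smul_const _), S1.tsum_smul_const,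
      S2.tsum_smul_const]
    rfl
  · intro i u hu
    obtain ⟨⟨h1, h2⟩, h3⟩ := hball u hu
    refine (norm_add_le _ _).trans (add_le_add ?_ ?_)
    · rw [norm_smul, norm_powTerm (h0 i) _ _ h3, show s - 1 + t = q - 1 by rw [← hq]; ring]
      refine (mul_le_of_le_one_right (by positivity) ContinuousLinearMap.norm_id_le).trans (h1 i)
    · rw [norm_smul, norm_powTerm (h0 i) _ _ h3, show s + (t - 1) = q - 1 by rw [← hq]; ring]
      refine (mul_le_of_le_one_right (by positivity) ?_).trans (h2 i)
      exact ContinuousLinearMap.opNorm_le_bound _ zero_le_one (by simp)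

lemma contDiffOn_powSum_nat (n : ℕ) : ∀ {α : ι → ℂ} {c d : ι → ℝ} {q s t : ℝ}
    (_ : ∀ i, c i ≠ 0 ∨ d i ≠ 0) (_ : LocallySummable α c d q) (_ : s + t = q),
    ContDiffOn ℝ n (powSum α c d s t) {u : ℂ | 0 < u.im} := by
  have ho : IsOpen {u : ℂ | 0 < u.im} := isOpen_lt continuous_const continuous_im
  induction n with
  | zero =>
    intro α c d q s t h0 H hq
    exact contDiffOn_zero.2 fun z hz =>
      (hasFDerivAt_powSum h0 H hq hz).continuousAt.continuousWithinAt
  | succ n ih =>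
    intro α c d q s t h0 H hq
    have := (contDiffOn_succ_iff_hasFDerivWithinAt_of_uniqueDiffOn (𝕜 := ℝ) (n := n)
      (f := powSum α c d s t) ho.uniqueDiffOn).2 ⟨by simp, _, ?_, fun z hz =>
        (hasFDerivAt_powSum h0 H hq hz).hasFDerivWithinAt⟩
    · exact_mod_cast this
    · exact ((ih h0 (H.deriv h0 s) (by rw [← hq]; ring)).smul contDiffOn_const).add
        ((ih h0 (H.deriv h0 t) (by rw [← hq]; ring)).smul contDiffOn_const)

lemma contDiffOn_powSum {α : ι → ℂ} {c d : ι → ℝ} {q s t : ℝ}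
    (h0 : ∀ i, c i ≠ 0 ∨ d i ≠ 0) (H : LocallySummable α c d q) (hq : s + t = q) :
    ContDiffOn ℝ ∞ (powSum α c d s t) {u : ℂ | 0 < u.im} :=
  contDiffOn_infty.2 fun n => contDiffOn_powSum_nat n h0 H hq

end PowSum

/-! ### Calculus on the upper half-plane -/

lemma isOpen_im_pos : IsOpen {u : ℂ | 0 < u.im} := isOpen_lt continuous_const continuous_im

lemma comp_ofComplex_eventuallyEq {f : ℍ → ℂ} {F : ℂ → ℂ} (hf : ∀ z : ℍ, f z = F z) (z : ℍ) :
    (fun u : ℂ => f (ofComplex u)) =ᶠ[𝓝 (z : ℂ)] F := by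
  filter_upwards [isOpen_im_pos.mem_nhds z.im_pos] with u hu
  rw [hf, ofComplex_apply_of_im_pos hu]

lemma dx_eq {f : ℍ → ℂ} {F : ℂ → ℂ} {L : ℂ →L[ℝ] ℂ} {z : ℍ} (hf : ∀ z : ℍ, f z = F z)
    (h : HasFDerivAt F L z) : dx f z = L 1 := by
  rw [dx, (h.congr_of_eventuallyEq (comp_ofComplex_eventuallyEq hf z)).fderiv]

lemma dy_eq {f : ℍ → ℂ} {F : ℂ → ℂ} {L : ℂ →L[ℝ] ℂ} {z : ℍ} (hf : ∀ z : ℍ, f z = F z)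
    (h : HasFDerivAt F L z) : dy f z = L Complex.I := by
  rw [dy, (h.congr_of_eventuallyEq (comp_ofComplex_eventuallyEq hf z)).fderiv]

/-- Smoothness of a function on the upper half-plane. -/
abbrev Smooth (f : ℍ → ℂ) : Prop :=
  ContDiffOn ℝ ∞ (fun u : ℂ => f (ofComplex u)) {u : ℂ | 0 < u.im}

lemma Smooth.differentiableAt {f : ℍ → ℂ} (hf : Smooth f) (z : ℍ) :
    DifferentiableAt ℝ (fun u : ℂ => f (ofComplex u)) z :=
  (hf.contDiffAt (isOpen_im_pos.mem_nhds z.im_pos)).differentiableAt (by simp)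

lemma Smooth.of_eq {f : ℍ → ℂ} {F : ℂ → ℂ} (hf : ∀ z : ℍ, f z = F z)
    (hF : ContDiffOn ℝ ∞ F {u : ℂ | 0 < u.im}) : Smooth f :=
  hF.congr fun u hu => by rw [hf, ofComplex_apply_of_im_pos hu]

lemma Smooth.dx {f : ℍ → ℂ} (hf : Smooth f) : Smooth (dx f) :=
  .of_eq (fun _ => rfl) ((((contDiffOn_infty_iff_fderiv_of_isOpen isOpen_im_pos).1 hf).2).clm_apply
    contDiffOn_const)

lemma Smooth.dy {f : ℍ → ℂ} (hf : Smooth f) : Smooth (dy f) :=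
  .of_eq (fun _ => rfl) ((((contDiffOn_infty_iff_fderiv_of_isOpen isOpen_im_pos).1 hf).2).clm_apply
    contDiffOn_const)

lemma dx_add {f g : ℍ → ℂ} (hf : Smooth f) (hg : Smooth g) (z : ℍ) :
    dx (f + g) z = dx f z + dx g z := by
  simp only [dx, Pi.add_apply]
  rw [fderiv_fun_add (hf.differentiableAt z) (hg.differentiableAt z)]
  rfl

lemma dy_add {f g : ℍ → ℂ} (hf : Smooth f) (hg : Smooth g) (z : ℍ) :
    dy (f + g) z = dy f z + dy g z := by
  simp only [dy, Pi.add_apply]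
  rw [fderiv_fun_add (hf.differentiableAt z) (hg.differentiableAt z)]
  rfl

lemma dx_smul {f : ℍ → ℂ} (hf : Smooth f) (a : ℂ) (z : ℍ) : dx (a • f) z = a * dx f z := by
  simp only [dx, Pi.smul_apply]
  rw [fderiv_fun_const_smul (hf.differentiableAt z)]
  rfl

lemma dy_smul {f : ℍ → ℂ} (hf : Smooth f) (a : ℂ) (z : ℍ) : dy (a • f) z = a * dy f z := by
  simp only [dy, Pi.smul_apply]
  rw [fderiv_fun_const_smul (hf.differentiableAt z)]
  rfl

lemma dx_dy_comm {f : ℍ → ℂ} (hf : Smooth f) (z : ℍ) : dx (dy f) z = dy (dx f) z := by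
  have h1 : ContDiffAt ℝ ∞ (fun u : ℂ => f (ofComplex u)) z :=
    hf.contDiffAt (isOpen_im_pos.mem_nhds z.im_pos)
  have h2 : HasFDerivAt (fderiv ℝ fun u : ℂ => f (ofComplex u)) _ (z : ℂ) :=
    ((((contDiffOn_infty_iff_fderiv_of_isOpen isOpen_im_pos).1 hf).2.contDiffAt
      (isOpen_im_pos.mem_nhds z.im_pos)).differentiableAt (by simp)).hasFDerivAt
  rw [dx_eq (f := dy f) (fun _ => rfl) (h2.clm_apply (hasFDerivAt_const Complex.I _)),
    dy_eq (f := dx f) (fun _ => rfl) (h2.clm_apply (hasFDerivAt_const 1 _))]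
  simpa using h1.isSymmSndFDerivAt (by
    rw [minSmoothness_of_isRCLikeNormedField]; exact ENat.LEInfty.out) 1 Complex.I

lemma shadow_add (κ : ℝ) {f g : ℍ → ℂ} (hf : Smooth f) (hg : Smooth g) :
    shadow κ (f + g) = shadow κ f + shadow κ g := by
  ext z
  simp only [shadow, dbar, dx_add hf hg, dy_add hf hg, Pi.add_apply, map_mul, map_add]
  ring

lemma shadow_smul (κ : ℝ) {f : ℍ → ℂ} (hf : Smooth f) (a : ℂ) :
    shadow κ (a • f) = conj a • shadow κ f := by
  ext z
  simp only [shadow, dbar, dx_smul hf, dy_smul hf, Pi.smul_apply, map_mul, map_add, smul_eq_mul]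
  ring

lemma laplacian_add (κ : ℝ) {f g : ℍ → ℂ} (hf : Smooth f) (hg : Smooth g) (z : ℍ) :
    laplacian κ (f + g) z = laplacian κ f z + laplacian κ g z := by
  have h1 : dx (f + g) = dx f + dx g := funext (dx_add hf hg)
  have h2 : dy (f + g) = dy f + dy g := funext (dy_add hf hg)
  simp only [laplacian, h1, h2, dx_add hf.dx hg.dx, dy_add hf.dy hg.dy, Pi.add_apply]
  ring

lemma laplacian_smul (κ : ℝ) {f : ℍ → ℂ} (hf : Smooth f) (a : ℂ) (z : ℍ) :
    laplacian κ (a • f) z = a * laplacian κ f z := by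
  have h1 : dx (a • f) = a • dx f := funext (dx_smul hf a)
  have h2 : dy (a • f) = a • dy f := funext (dy_smul hf a)
  simp only [laplacian, h1, h2, dx_smul hf.dx, dy_smul hf.dy, Pi.smul_apply, smul_eq_mul]
  ring

lemma hasFDerivAt_im_rpow (a : ℝ) {z : ℂ} (hz : 0 < z.im) :
    HasFDerivAt (fun u : ℂ => ((u.im ^ a : ℝ) : ℂ))
      (((a * z.im ^ (a - 1) : ℝ) : ℂ) • (ofRealCLM ∘L imCLM)) z := by
  have h1 : HasFDerivAt (fun u : ℂ => u.im ^ a) _ z :=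
    (imCLM.hasFDerivAt (x := z)).rpow_const (p := a) (.inl hz.ne')
  refine (ofRealCLM.hasFDerivAt.comp z h1).congr_fderiv ?_
  ext
  all_goals simp

lemma contDiffOn_im_rpow (a : ℝ) :
    ContDiffOn ℝ ∞ (fun u : ℂ => ((u.im ^ a : ℝ) : ℂ)) {u : ℂ | 0 < u.im} :=
  ofRealCLM.contDiff.comp_contDiffOn
    (imCLM.contDiff.contDiffOn.rpow_const_of_ne fun _ hu => ne_of_gt hu)

/-! ### Weighted sums annihilated by the Laplacian -/

section WeightedSum

variable {ι : Type*} {α : ι → ℂ} {c d : ι → ℝ} {k : ℝ}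

/-- The function `y ^ (k - 1) / (k - 1) * ∑ α (c z + d)⁻¹ * conj ((c z + d) ^ (1 - k))`. -/
def weightedSum (k : ℝ) (α : ι → ℂ) (c d : ι → ℝ) (z : ℂ) : ℂ :=
  (((k - 1)⁻¹ : ℝ) : ℂ) * (((z.im ^ (k - 1) : ℝ) : ℂ) * powSum α c d (-1) (1 - k) z)

lemma contDiffOn_weightedSum (h0 : ∀ i, c i ≠ 0 ∨ d i ≠ 0) (H : LocallySummable α c d (-k)) :
    ContDiffOn ℝ ∞ (weightedSum k α c d) {u : ℂ | 0 < u.im} :=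
  contDiffOn_const.mul ((contDiffOn_im_rpow _).mul (contDiffOn_powSum h0 H (by ring)))

/-- The left side is 2 ∂f/∂z̄. Differentiating y ^ (k-1) and conj(J ^ (1-k)) yields iJ⁻¹ conj(J ^
(-k)) (conj J + 2icy) per term, up to y ^ (k-2), and the last bracket is J (`e6`). The J⁻¹ cancels,
leaving an antiholomorphic sum. -/
lemma dbar_weightedSum (hk : k ≠ 1) (h0 : ∀ i, c i ≠ 0 ∨ d i ≠ 0)
    (H : LocallySummable α c d (-k)) {f : ℍ → ℂ} (hf : ∀ z : ℍ, f z = weightedSum k α c d z)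
    (z : ℍ) : dx f z + Complex.I * dy f z =
      Complex.I * (((z.im ^ (k - 2) : ℝ) : ℂ) * powSum α c d 0 (-k) z) := by
  have hz : 0 < (z : ℂ).im := z.im_pos
  have hk1 : k - 1 ≠ 0 := sub_ne_zero.2 hk
  have h1 := (((hasFDerivAt_im_rpow (k - 1) hz).mul
    (hasFDerivAt_powSum h0 H (s := -1) (t := 1 - k) (by ring) hz)).const_mul
      (((k - 1)⁻¹ : ℝ) : ℂ))
  rw [dx_eq hf h1, dy_eq hf h1]
  have S1 := H.summable h0 (show (-1) + (1 - k) = -k by ring) hz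
  have S2 := (H.deriv h0 (1 - k)).summable h0 (show (-1) + (1 - k - 1) = -k - 1 by ring) hz
  have key : Complex.I * powSum α c d (-1) (1 - k) z + 2 * (((k - 1)⁻¹ : ℝ) : ℂ) * z.im *
      powSum (fun i => ((1 - k : ℝ) : ℂ) * α i * c i) c d (-1) (1 - k - 1) z =
      Complex.I * powSum α c d 0 (-k) z := by
    simp only [powSum]
    rw [← tsum_mul_left, ← tsum_mul_left, ← tsum_mul_left,
      ← Summable.tsum_add (S1.mul_left _) (S2.mul_left _)]
    refine tsum_congr fun i => ?_
    have hJ := affine_ne_zero (h0 i) hz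
    have e1 : ((1 - k : ℝ) : ℂ) = ((-k : ℝ) : ℂ) + 1 := by push_cast; ring
    have e2 : ((1 - k - 1 : ℝ) : ℂ) = ((-k : ℝ) : ℂ) := by push_cast; ring
    have e3 : ((-1 : ℝ) : ℂ) = -1 := by simp
    have e4 : ((0 : ℝ) : ℂ) = 0 := by simp
    have e5 : (((k - 1)⁻¹ : ℝ) : ℂ) * (((-k : ℝ) : ℂ) + 1) = -1 := by
      rw [← e1, ← ofReal_mul, ← ofReal_one, ← ofReal_neg]
      congr 1
      field_simp
      ring
    have e6 : conj (c i * (z : ℂ) + d i : ℂ) + 2 * Complex.I * c i * z.im = c i * z + d i := by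
      apply Complex.ext
      · simp
      · simp; ring
    rw [powTerm, powTerm, powTerm, e2, e1, e3, e4, cpow_add _ _ hJ, cpow_one, cpow_neg_one,
      cpow_zero, map_mul]
    generalize (((k - 1)⁻¹ : ℝ) : ℂ) = K at e5 ⊢
    field_simp
    linear_combination (α i * conj ((c i * (z : ℂ) + d i) ^ ((-k : ℝ) : ℂ))) *
      (Complex.I * e6 + 2 * z.im * c i * e5 - 2 * z.im * c i * Complex.I_sq)
  have e8 : z.im ^ (k - 1) = z.im ^ (k - 2) * z.im := by
    rw [← Real.rpow_add_one z.im_pos.ne']; ring_nf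
  have e9 : (((k - 1)⁻¹ : ℝ) : ℂ) * ((k - 1 : ℝ) : ℂ) = 1 := by
    rw [← ofReal_mul, inv_mul_cancel₀ hk1, ofReal_one]
  rw [show k - 1 - 1 = k - 2 by ring]
  simp only [FunLike.coe_add, FunLike.coe_smul, Pi.add_apply, Pi.smul_apply, smul_eq_mul,
    ContinuousLinearMap.coe_comp, Function.comp_apply, ContinuousLinearMap.coe_id', id,
    ContinuousLinearEquiv.coe_coe, conjCLE_apply, map_one, conj_I, imCLM_apply, ofRealCLM_apply,
    one_im, Complex.I_im, ofReal_zero, ofReal_one, coe_im, e8, ofReal_mul]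
  linear_combination ((z.im ^ (k - 2) : ℝ) : ℂ) * key + ((z.im ^ (k - 2) : ℝ) : ℂ) *
    powSum α c d (-1) (1 - k) z * Complex.I * e9 + (((k - 1)⁻¹ : ℝ) : ℂ) *
    ((z.im ^ (k - 2) : ℝ) : ℂ) * z.im *
    (powSum (fun i => ((-1 : ℝ) : ℂ) * α i * c i) c d (-1 - 1) (1 - k) z -
      powSum (fun i => ((1 - k : ℝ) : ℂ) * α i * c i) c d (-1) (1 - k - 1) z) * Complex.I_sq

/-- The second-order part factors as -y² (∂x - i∂y)(∂x + i∂y). On i y ^ (k-2) G with G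
antiholomorphic, ∂x - i∂y only sees the power of y, and the result cancels the first-order term of
weight 2-k. -/
lemma laplacian_eq_zero (h0 : ∀ i, c i ≠ 0 ∨ d i ≠ 0) (H : LocallySummable α c d (-k))
    {f : ℍ → ℂ} (hf : Smooth f)
    (hD : ∀ z : ℍ, dx f z + Complex.I * dy f z =
      Complex.I * (((z.im ^ (k - 2) : ℝ) : ℂ) * powSum α c d 0 (-k) z)) (z : ℍ) :
    laplacian (2 - k) f z = 0 := by
  have hz : 0 < (z : ℂ).im := z.im_pos
  have h1 := (((hasFDerivAt_im_rpow (k - 2) hz).mul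
    (hasFDerivAt_powSum h0 H (s := 0) (t := -k) (by ring) hz)).const_mul Complex.I)
  have hD' : ∀ z : ℍ, (dx f + Complex.I • dy f) z =
      Complex.I * (((z.im ^ (k - 2) : ℝ) : ℂ) * powSum α c d 0 (-k) z) := hD
  have hI : Smooth (Complex.I • dy f) := contDiffOn_const.mul hf.dy
  -- With exponent s = 0 the holomorphic derivative vanishes: the sum is antiholomorphic.
  rw [show powSum (fun i => ((0 : ℝ) : ℂ) * α i * c i) c d (0 - 1) (-k) z = 0 by
    simp [powSum, powTerm]] at h1
  have hx := dx_eq hD' h1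
  have hy := dy_eq hD' h1
  rw [dx_add hf.dx hI, dx_smul hf.dy] at hx
  rw [dy_add hf.dx hI, dy_smul hf.dy] at hy
  have e1 : z.im ^ (k - 2) = z.im ^ (k - 2 - 1) * z.im := by
    rw [← Real.rpow_add_one z.im_pos.ne']; ring_nf
  rw [laplacian, hD z]
  rw [dx_dy_comm hf] at hx
  simp only [FunLike.coe_add, FunLike.coe_smul, Pi.add_apply, Pi.smul_apply, smul_eq_mul,
    ContinuousLinearMap.coe_comp, Function.comp_apply, ContinuousLinearMap.coe_id', id,
    ContinuousLinearEquiv.coe_coe, conjCLE_apply, map_one, conj_I, imCLM_apply, ofRealCLM_apply,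
    one_im, Complex.I_im, ofReal_zero, ofReal_one, coe_im, ofReal_mul] at hx hy
  rw [e1, ofReal_mul] at hx hy ⊢
  push_cast at hx hy ⊢
  linear_combination (-(z.im : ℂ) ^ 2) * hx + (z.im : ℂ) ^ 2 * Complex.I * hy + (-(z.im : ℂ) ^ 2 *
    dy (dy f) z - (z.im : ℂ) ^ 3 * Complex.I * ((z.im ^ (k - 2 - 1) : ℝ) : ℂ) *
    powSum (fun i => -k * α i * c i) c d 0 (-k - 1) z) * Complex.I_sq

end WeightedSum

/-! ### Bottom rows of matrices in `SL(2, ℤ)` -/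

/-- The stabilizer of `∞` in `SL(2, ℤ)`. -/
def stabInfty : Subgroup SL(2, ℤ) :=
  (MulAction.stabilizer (GL (Fin 2) ℝ) (OnePoint.infty : OnePoint ℝ)).comap (mapGL ℝ)

lemma mem_stabInfty {h : SL(2, ℤ)} : h ∈ stabInfty ↔ h 1 0 = 0 := by
  rw [stabInfty, Subgroup.mem_comap, MulAction.mem_stabilizer_iff,
    OnePoint.smul_infty_eq_self_iff]
  exact Int.cast_eq_zero (α := ℝ)

lemma mul_inv_mem_stabInfty {g h : SL(2, ℤ)} :
    g * h⁻¹ ∈ stabInfty ↔ g 1 0 * h 1 1 = g 1 1 * h 1 0 := by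
  have h1 : ((g * h⁻¹ : SL(2, ℤ)) : Matrix (Fin 2) (Fin 2) ℤ) 1 0 =
      g 1 0 * h 1 1 - g 1 1 * h 1 0 := by
    simp [Matrix.SpecialLinearGroup.coe_inv, Matrix.adjugate_fin_two, Matrix.mul_apply,
      Fin.sum_univ_two, sub_eq_add_neg]
  exact mem_stabInfty.trans (h1 ▸ sub_eq_zero)

lemma j_intCast (h : SL(2, ℤ)) (z : ℍ) :
    j (h : SL(2, ℝ)) z = (h 1 0 : ℂ) * z + (h 1 1 : ℂ) := by
  simp [j]

lemma j_mul_intCast (g h : SL(2, ℤ)) (z : ℍ) :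
    j ((g * h : SL(2, ℤ)) : SL(2, ℝ)) z =
      j (g : SL(2, ℝ)) ((h : SL(2, ℝ)) • z) * j (h : SL(2, ℝ)) z := by
  rw [map_mul, j_mul]

lemma exists_sign_of_mem_stabInfty {p : SL(2, ℤ)} (hp : p ∈ stabInfty) :
    ∃ ε : ℝ, (ε = 1 ∨ ε = -1) ∧ ∀ z, j (p : SL(2, ℝ)) z = ε := by
  rw [mem_stabInfty] at hp
  have hdet := p.det_coe
  rw [Matrix.det_fin_two, hp, mul_zero, sub_zero, mul_comm] at hdet
  refine ⟨p 1 1, ?_, fun z => by simp [j_intCast, hp]⟩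
  rcases Int.isUnit_iff.1 (IsUnit.of_mul_eq_one _ hdet) with h | h <;> simp [h]

lemma bottom_row_ne_zero (h : SL(2, ℤ)) : h 1 0 ≠ 0 ∨ h 1 1 ≠ 0 := by
  by_contra! h0
  have hdet := h.det_coe
  rw [Matrix.det_fin_two, h0.1, h0.2] at hdet
  simp at hdet

/-- A family of matrices in distinct cosets of the stabilizer of `∞`. -/
def DistinctRows {ι : Type*} (h : ι → SL(2, ℤ)) : Prop :=
  ∀ x y, h x * (h y)⁻¹ ∈ stabInfty → x = y

lemma DistinctRows.injective {ι : Type*} {h : ι → SL(2, ℤ)} (H : DistinctRows h) :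
    Function.Injective fun i => (h i : Matrix (Fin 2) (Fin 2) ℤ) 1 := by
  intro x y hxy
  refine H x y (mul_inv_mem_stabInfty.2 ?_)
  have h0 := congrFun hxy 0
  have h1 := congrFun hxy 1
  simp only at h0 h1
  rw [h0, h1, mul_comm]

lemma DistinctRows.mul_right {ι : Type*} {h : ι → SL(2, ℤ)} (H : DistinctRows h)
    (g : SL(2, ℤ)) : DistinctRows fun i => h i * g := by
  intro x y hxy
  refine H x y ?_
  convert hxy using 1
  group

lemma DistinctRows.summable_norm_rpow {ι : Type*} {h : ι → SL(2, ℤ)} (H : DistinctRows h)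
    {k : ℝ} (hk : 2 < k) :
    Summable fun i => ‖(h i : Matrix (Fin 2) (Fin 2) ℤ) 1‖ ^ (-k) :=
  (EisensteinSeries.summable_one_div_norm_rpow hk).comp_injective H.injective

/-- On a vertical strip |cu + d| is bounded below by a constant times the norm of (c, d), so the
lattice sum over all integer pairs, convergent for k > 2, dominates. -/
lemma DistinctRows.locallySummable {ι : Type*} {h : ι → SL(2, ℤ)} (H : DistinctRows h)
    {k : ℝ} (hk : 2 < k) {t : ℝ} {α : ι → ℂ} {B : ℝ} (hα : ∀ i, ‖α i‖ ≤ B) :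
    LocallySummable α (fun i => t * h i 1 0) (fun i => t * h i 1 1) (-k) := by
  intro z hz
  refine ⟨fun i => B * (|t| ^ (-k) * (EisensteinSeries.r ⟨⟨|z.re| + 1, z.im / 2⟩, half_pos hz⟩ ^ (-k) *
    ‖(h i : Matrix (Fin 2) (Fin 2) ℤ) 1‖ ^ (-k))),
    (((H.summable_norm_rpow hk).mul_left _).mul_left _).mul_left _, ?_⟩
  filter_upwards [(continuous_im.tendsto z).eventually (lt_mem_nhds (half_lt_self hz)),
    (continuous_re.abs.tendsto z).eventually (gt_mem_nhds (lt_add_one |z.re|))] with u hu1 hu2 i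
  have hB : 0 ≤ B := (norm_nonneg _).trans (hα i)
  have hu0 : 0 < u.im := (half_pos hz).trans hu1
  have key := EisensteinSeries.summand_bound_of_mem_verticalStrip (z := ⟨u, hu0⟩)
    (by linarith : 0 ≤ k) ((h i : Matrix (Fin 2) (Fin 2) ℤ) 1) (half_pos hz)
    (A := |z.re| + 1) ⟨hu2.le, hu1.le⟩
  have e : (((t * h i 1 0 : ℝ) : ℂ) * u + ((t * h i 1 1 : ℝ) : ℂ)) =
      t * ((h i 1 0 : ℂ) * u + (h i 1 1 : ℂ)) := by push_cast; ring
  rw [e, norm_mul, norm_real, Real.norm_eq_abs, Real.mul_rpow (abs_nonneg _) (norm_nonneg _)]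
  gcongr
  exact hα i

/-- The constant must serve every family and every z with Im z ≥ 1, so that a single bound works at
all cusps. -/
lemma exists_tsum_norm_j_le {k : ℝ} (hk : 2 < k) : ∃ C : ℝ, ∀ {ι : Type} {h : ι → SL(2, ℤ)}
    (_ : DistinctRows h) (z : ℍ), 1 ≤ z.im →
      ∑' i, ‖j (h i : SL(2, ℝ)) z‖ ^ (-k) ≤ C := by
  refine ⟨EisensteinSeries.r ⟨⟨1, 1⟩, one_pos⟩ ^ (-k) * ∑' x : Fin 2 → ℤ, ‖x‖ ^ (-k), ?_⟩
  intro ι h H z hz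
  -- Translation by an integer moves z into the strip |x| ≤ 1, y ≥ 1; multiplying the matrices by a
  -- power of T compensates and keeps their rows distinct.
  set n : ℤ := ⌊z.re⌋
  set w : ℍ := ((ModularGroup.T ^ (-n) : SL(2, ℤ)) : SL(2, ℝ)) • z with hw
  have hwz : z = ((ModularGroup.T ^ n : SL(2, ℤ)) : SL(2, ℝ)) • w := by
    rw [hw, ← mul_smul, ← map_mul]; simp
  have hwc : (w : ℂ) = z + ((-n : ℤ) : ℂ) := ModularGroup.coe_T_zpow_smul_eq z
  have hwim : w.im = z.im := by
    have := congrArg Complex.im hwc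
    simpa using this
  have hwre : w.re = z.re - n := by
    have := congrArg Complex.re hwc
    simpa [sub_eq_add_neg] using this
  have hstrip : w ∈ verticalStrip 1 1 := by
    refine ⟨?_, hwim ▸ hz⟩
    rw [hwre, abs_of_nonneg (sub_nonneg.2 (Int.floor_le _))]
    linarith [Int.lt_floor_add_one z.re]
  have H' := H.mul_right (ModularGroup.T ^ n)
  have hT : j ((ModularGroup.T ^ n : SL(2, ℤ)) : SL(2, ℝ)) w = 1 := by
    rw [j_intCast, ModularGroup.coe_T_zpow]; simp
  have hj : ∀ i, j (h i : SL(2, ℝ)) z =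
      j ((h i * ModularGroup.T ^ n : SL(2, ℤ)) : SL(2, ℝ)) w := fun i => by
    rw [j_mul_intCast, hT, mul_one, ← hwz]
  have hb : ∀ i, ‖j (h i : SL(2, ℝ)) z‖ ^ (-k) ≤ EisensteinSeries.r ⟨⟨1, 1⟩, one_pos⟩ ^ (-k) *
      ‖((h i * ModularGroup.T ^ n : SL(2, ℤ)) : Matrix (Fin 2) (Fin 2) ℤ) 1‖ ^ (-k) := fun i => by
    rw [hj, j_intCast]
    exact EisensteinSeries.summand_bound_of_mem_verticalStrip (by linarith) _ one_pos hstrip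
  have hs := (H'.summable_norm_rpow hk).mul_left (EisensteinSeries.r ⟨⟨1, 1⟩, one_pos⟩ ^ (-k))
  refine ((hs.of_nonneg_of_le (fun i => by positivity) hb).tsum_le_tsum hb hs).trans ?_
  rw [tsum_mul_left]
  gcongr
  · exact (Real.rpow_pos_of_pos (EisensteinSeries.r_pos _) _).le
  · exact tsum_comp_le_tsum_of_inj (EisensteinSeries.summable_one_div_norm_rpow hk)
      (fun _ => by positivity) H'.injective

/-! ### Representatives of cusps -/

/-- The matrix `r` maps `∞` to the cusp `a`, and `j(σ⁻¹ g, z) = t j(r⁻¹ g, z)`. -/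
structure IsCuspRep (Γ : Subgroup SL(2, ℤ)) (a : OnePoint ℝ) (σ : SL(2, ℝ)) (r : SL(2, ℤ))
    (t : ℝ) : Prop where
  ne_zero : t ≠ 0
  mem_stab : ∀ γ : Γ, γ ∈ stab Γ a ↔ r⁻¹ * γ * r ∈ stabInfty
  j_eq : ∀ (g : SL(2, ℤ)) (z : ℍ),
    j (σ⁻¹ * (g : SL(2, ℝ))) z = t * j ((r⁻¹ * g : SL(2, ℤ)) : SL(2, ℝ)) z

/-- Every cusp is r∞ with r in SL(2, ℤ). Then σ⁻¹ r fixes ∞, so its automorphy factor is a nonzero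
real constant t. This trades the real matrix σ⁻¹ for an integral one. -/
lemma IsSingularCusp.exists_isCuspRep {Γ : Subgroup SL(2, ℤ)} {κ : ℝ} {ν : Γ → ℂ}
    {a : OnePoint ℝ} {σ : SL(2, ℝ)} (h : IsSingularCusp Γ κ ν a σ) :
    ∃ r t, IsCuspRep Γ a σ r t := by
  obtain ⟨r, hr⟩ := isCusp_SL2Z_iff'.1 (h.isCusp.mono (by rintro _ ⟨γ, _, rfl⟩; exact ⟨γ, rfl⟩))
  have h1 : ((σ⁻¹ * (r : SL(2, ℝ)) : SL(2, ℝ)) : GL (Fin 2) ℝ) • (OnePoint.infty : OnePoint ℝ) =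
      OnePoint.infty := by
    have h2 := h.isScaling.map_infty
    rw [map_mul, mul_smul, map_inv]
    rw [inv_smul_eq_iff, h2, hr]
    rfl
  rw [OnePoint.smul_infty_eq_self_iff] at h1
  have h1 : (σ⁻¹ * (r : SL(2, ℝ)) : SL(2, ℝ)) 1 0 = 0 := h1
  have hj : ∀ z, j (σ⁻¹ * (r : SL(2, ℝ))) z = (((σ⁻¹ * (r : SL(2, ℝ)) : SL(2, ℝ)) 1 1 : ℝ) : ℂ) :=
    fun z => by rw [j, h1]; simp
  refine ⟨r, (σ⁻¹ * (r : SL(2, ℝ)) : SL(2, ℝ)) 1 1, ?_, ?_, ?_⟩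
  · intro h0
    have := hj UpperHalfPlane.I
    rw [h0] at this
    exact j_ne_zero _ _ (this.trans ofReal_zero)
  · intro γ
    rw [stab, stabInfty, Subgroup.mem_comap, Subgroup.mem_comap, MulAction.mem_stabilizer_iff,
      MulAction.mem_stabilizer_iff, hr, map_mul, map_mul, map_inv, mul_smul, mul_smul,
      inv_smul_eq_iff]
    rfl
  · intro g z
    rw [← hj ((((r⁻¹ * g : SL(2, ℤ)) : SL(2, ℝ))) • z), ← j_mul, map_mul, map_inv]
    congr 1
    group

lemma IsCuspRep.distinctRows {Γ : Subgroup SL(2, ℤ)} {a : OnePoint ℝ} {σ : SL(2, ℝ)}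
    {r : SL(2, ℤ)} {t : ℝ} (h : IsCuspRep Γ a σ r t) :
    DistinctRows fun q : Cosets Γ a => r⁻¹ * (q.out : SL(2, ℤ)) := by
  intro x y hxy
  rw [← Quotient.out_eq x, ← Quotient.out_eq y]
  refine Quotient.sound ?_
  change QuotientGroup.rightRel _ _ _
  rw [QuotientGroup.rightRel_apply, h.mem_stab, ← inv_mem_iff]
  convert hxy using 1
  simp
  group

/-! ### The cocycle `w` and the terms of the series -/

lemma continuous_coe_j (g : SL(2, ℝ)) : Continuous fun z : ℍ => j g z := by
  unfold j
  fun_prop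

/-- When the lower left entry is zero, j is constant, so the cut of the logarithm does no harm. -/
lemma continuous_log_j (g : SL(2, ℝ)) : Continuous fun z : ℍ => Complex.log (j g z) := by
  by_cases hc : g 1 0 = 0
  · have : (fun z : ℍ => Complex.log (j g z)) = fun _ => Complex.log (g 1 1 : ℂ) := by
      ext z; simp [j, hc]
    rw [this]
    exact continuous_const
  · refine (continuous_coe_j g).clog fun z => Or.inr ?_
    simpa [j] using ⟨hc, z.im_pos.ne'⟩

/-- The cocycle `w` does not depend on the point. -/
lemma w_eq_w (κ : ℝ) (g h : SL(2, ℝ)) (z z' : ℍ) : w κ g h z = w κ g h z' := by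
  -- θ is continuous with values in 2πiℤ, because its exponential is 1 by the cocycle relation for
  -- j; connectedness of the half-plane makes it constant.
  set θ : ℍ → ℂ := fun z => Complex.log (j g (h • z)) + Complex.log (j h z) -
    Complex.log (j (g * h) z) with hθ
  have hw : ∀ z, w κ g h z = cexp (κ * θ z) := fun z => by
    rw [w, cpow_def_of_ne_zero (j_ne_zero _ _), cpow_def_of_ne_zero (j_ne_zero _ _),
      cpow_def_of_ne_zero (j_ne_zero _ _), ← Complex.exp_add, ← Complex.exp_add]
    congr 1
    simp only [hθ]
    ring
  have hθc : Continuous θ :=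
    (((continuous_log_j g).comp (continuous_const_smul h)).add (continuous_log_j h)).sub
      (continuous_log_j (g * h))
  have hexp : ∀ z, ∃ n : ℤ, θ z = n * (2 * Real.pi * Complex.I) := fun z => by
    refine Complex.exp_eq_one_iff.1 ?_
    rw [hθ]
    simp only
    rw [Complex.exp_sub, Complex.exp_add, Complex.exp_log (j_ne_zero _ _),
      Complex.exp_log (j_ne_zero _ _), Complex.exp_log (j_ne_zero _ _), j_mul]
    exact div_self (mul_ne_zero (j_ne_zero _ _) (j_ne_zero _ _))
  choose n hn using hexp
  have hnc : Continuous n := by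
    rw [Int.isClosedEmbedding_coe_real.isEmbedding.continuous_iff]
    have : ((↑) : ℤ → ℝ) ∘ n = fun z => (θ z).im / (2 * Real.pi) := by
      ext z
      rw [hn z]
      simp [Real.pi_ne_zero]
    rw [this]
    exact (continuous_im.comp hθc).div_const _
  rw [hw, hw, hn, hn, PreconnectedSpace.constant inferInstance hnc (x := z) (y := z')]

/-- Since x ^ k x ^ (2-k) = x² and squares of j are multiplicative, the cocycles of weights k and
2-k are inverse to each other; being unimodular, they are conjugate. -/
lemma conj_w (k : ℝ) (g h : SL(2, ℝ)) (z : ℍ) : conj (w k g h z) = w (2 - k) g h z := by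
  rw [← inv_eq_conj (norm_w k g h z)]
  refine inv_eq_of_mul_eq_one_right ?_
  have e : ∀ {x : ℂ}, x ≠ 0 → x ^ (k : ℂ) * x ^ ((2 - k : ℝ) : ℂ) = x ^ 2 := fun hx => by
    rw [← cpow_add _ _ hx]; push_cast; simp
  have e' : ∀ {x : ℂ}, x ≠ 0 → x ^ (-k : ℂ) * x ^ (-((2 - k : ℝ) : ℂ)) = (x ^ 2)⁻¹ := fun hx => by
    rw [cpow_neg, cpow_neg, ← mul_inv, e hx]
  have h1 := e (j_ne_zero g (h • z))
  have h2 := e (j_ne_zero h z)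
  have h3 := e' (j_ne_zero (g * h) z)
  have h4 : (j (g * h) z) ^ 2 ≠ 0 := pow_ne_zero _ (j_ne_zero _ _)
  calc w k g h z * w (2 - k) g h z
      = (j g (h • z) ^ (k : ℂ) * j g (h • z) ^ ((2 - k : ℝ) : ℂ)) *
        (j h z ^ (k : ℂ) * j h z ^ ((2 - k : ℝ) : ℂ)) *
        (j (g * h) z ^ (-k : ℂ) * j (g * h) z ^ (-((2 - k : ℝ) : ℂ))) := by
        rw [w, w]; ring
    _ = 1 := by
        rw [h1, h2, h3, ← mul_pow, ← j_mul, mul_inv_cancel₀ h4]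

variable {Γ : Subgroup SL(2, ℤ)} {k : ℝ} {ν : Γ → ℂ}

/-- The unimodular factor of the term of the mock Eisenstein series. -/
def coeff (k : ℝ) (ν : Γ → ℂ) (σ : SL(2, ℝ)) (γ : Γ) : ℂ :=
  conj (ν γ) * conj (w (2 - k) σ⁻¹ ((γ : SL(2, ℤ)) : SL(2, ℝ)) UpperHalfPlane.I)

lemma norm_coeff (hν : IsMultiplierSystem Γ (2 - k) ν) (σ : SL(2, ℝ)) (γ : Γ) :
    ‖coeff k ν σ γ‖ = 1 := by
  rw [coeff, norm_mul, RCLike.norm_conj, RCLike.norm_conj, hν.norm_eq_one, norm_w, one_mul]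

/-- Writes |J| ^ (2-2k) as J ^ (1-k) times its conjugate, which brings the term to the shape of
`powTerm`. The base point i in `coeff` is arbitrary. -/
lemma eisTerm_mul_norm_rpow (σ : SL(2, ℝ)) (γ : Γ) (z : ℍ) :
    eisTerm (2 - k) ν σ γ z *
      (‖j (σ⁻¹ * ((γ : SL(2, ℤ)) : SL(2, ℝ))) z‖ : ℂ) ^ (-2 * ((k - 1 : ℝ) : ℂ)) =
    coeff k ν σ γ * (j (σ⁻¹ * ((γ : SL(2, ℤ)) : SL(2, ℝ))) z ^ ((-1 : ℝ) : ℂ) *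
      conj (j (σ⁻¹ * ((γ : SL(2, ℤ)) : SL(2, ℝ))) z ^ ((1 - k : ℝ) : ℂ))) := by
  have hJ := j_ne_zero (σ⁻¹ * ((γ : SL(2, ℤ)) : SL(2, ℝ))) z
  rw [eisTerm, w_eq_w _ _ _ z UpperHalfPlane.I, coeff]
  generalize j (σ⁻¹ * ((γ : SL(2, ℤ)) : SL(2, ℝ))) z = J at hJ ⊢
  have h1 : J ^ (-((2 - k : ℝ) : ℂ)) = J ^ ((-1 : ℝ) : ℂ) * (J ^ ((1 - k : ℝ) : ℂ))⁻¹ := by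
    rw [← cpow_neg, ← cpow_add _ _ hJ]
    congr 1
    push_cast
    ring
  have h2 : (‖J‖ : ℂ) ^ (-2 * ((k - 1 : ℝ) : ℂ)) =
      J ^ ((1 - k : ℝ) : ℂ) * conj (J ^ ((1 - k : ℝ) : ℂ)) := by
    rw [mul_conj, normSq_eq_norm_sq, norm_cpow_of_ne_zero hJ]
    have : (-2 * ((k - 1 : ℝ) : ℂ)) = (((1 - k) * 2 : ℝ) : ℂ) := by push_cast; ring
    rw [this, ← ofReal_cpow (norm_nonneg _), Real.rpow_mul (norm_nonneg _)]
    simp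
  rw [h1, h2]
  have h3 : J ^ ((1 - k : ℝ) : ℂ) ≠ 0 := by
    rw [Ne, cpow_eq_zero_iff]; exact fun h => hJ h.1
  field_simp

lemma eisTerm_conj (σ : SL(2, ℝ)) (γ : Γ) (z : ℍ) :
    eisTerm k (fun γ => conj (ν γ)) σ γ z =
    conj (coeff k ν σ γ * (j (σ⁻¹ * ((γ : SL(2, ℤ)) : SL(2, ℝ))) z ^ ((0 : ℝ) : ℂ) *
      conj (j (σ⁻¹ * ((γ : SL(2, ℤ)) : SL(2, ℝ))) z ^ ((-k : ℝ) : ℂ)))) := by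
  rw [eisTerm, w_eq_w _ _ _ z UpperHalfPlane.I, coeff, conj_w]
  simp

/-- Singularity of a cusp for `ν` in weight `2 - k` and for `conj ν` in weight `k` agree. -/
lemma isSingularCusp_conj_iff (hν : ∀ γ, ‖ν γ‖ = 1) {a : OnePoint ℝ} {σ : SL(2, ℝ)} :
    IsSingularCusp Γ k (fun γ => conj (ν γ)) a σ ↔ IsSingularCusp Γ (2 - k) ν a σ := by
  suffices H : IsScaling Γ a σ →
      (IsSingular Γ k (fun γ => conj (ν γ)) a σ ↔ IsSingular Γ (2 - k) ν a σ) from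
    ⟨fun h => ⟨h.1, h.2, (H h.2).1 h.3⟩, fun h => ⟨h.1, h.2, (H h.2).2 h.3⟩⟩
  intro hs
  refine forall₂_congr fun γ hγ => forall_congr' fun z => ?_
  set g : SL(2, ℝ) := ((γ : SL(2, ℤ)) : SL(2, ℝ)) with hg
  have hA := j_ne_zero g z
  have hB := j_ne_zero σ⁻¹ (g • z)
  have hD := j_ne_zero σ⁻¹ z
  -- σ⁻¹γσ is ± a translation, with automorphy factor ±1, so squaring removes the sign. The two
  -- singularity conditions are then inverse to each other modulo this identity.
  have hsq : (j g z) ^ 2 * (j σ⁻¹ (g • z)) ^ 2 = (j σ⁻¹ z) ^ 2 := by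
    obtain ⟨n, hn⟩ := (hs.conj_stab (σ⁻¹ * g * σ)).1 ⟨γ, hγ, Or.inl rfl⟩
    have h1 : j σ⁻¹ (g • z) * j g z = j (σ⁻¹ * g * σ) (σ⁻¹ • z) * j σ⁻¹ z := by
      rw [← j_mul, ← j_mul]
      congr 1
      group
    have hT : ∀ z, j (transl n) z = 1 := fun z => by
      rw [transl, j_intCast, ModularGroup.coe_T_zpow]; simp
    have hT' : ∀ z, j (-transl n) z = -1 := fun z => by
      rw [← hT z]; simp [j]; ring
    rw [← mul_pow, mul_comm, h1]
    rcases hn with hn | hn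
    · rw [hn, hT]; ring
    · rw [hn, hT']; ring
  have e : ∀ {x : ℂ}, x ≠ 0 → x ^ ((2 - k : ℝ) : ℂ) = x ^ 2 * (x ^ (k : ℂ))⁻¹ := fun hx => by
    rw [← cpow_neg, ← cpow_ofNat, ← cpow_add _ _ hx]; push_cast; rfl
  have e0 : ∀ {x : ℂ}, x ≠ 0 → x ^ (k : ℂ) ≠ 0 := fun hx h0 => hx ((cpow_eq_zero_iff _ _).1 h0).1
  beta_reduce
  rw [e hA, e hB, e hD, ← hsq, ← inv_eq_conj (hν γ)]
  have h1 := e0 hA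
  have h2 := e0 hB
  have h3 := e0 hD
  have h4 : ν γ ≠ 0 := fun h0 => by simpa [h0] using hν γ
  generalize j g z ^ (k : ℂ) = A at h1 ⊢
  generalize j σ⁻¹ (g • z) ^ (k : ℂ) = B at h2 ⊢
  generalize j σ⁻¹ z ^ (k : ℂ) = D at h3 ⊢
  field_simp
  constructor
  · intro h; rw [h]
  · intro h; rw [h]

/-! ### Eisenstein series at a cusp as sums over rows, and their shadows -/

section Series

variable {a : OnePoint ℝ} {σ : SL(2, ℝ)} {r : SL(2, ℤ)} {t : ℝ}

lemma IsCuspRep.j_eq_affine (hr : IsCuspRep Γ a σ r t) (g : SL(2, ℤ)) (z : ℍ) :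
    j (σ⁻¹ * (g : SL(2, ℝ))) z = ((t * (r⁻¹ * g) 1 0 : ℝ) : ℂ) * z + ((t * (r⁻¹ * g) 1 1 : ℝ) : ℂ) := by
  rw [hr.j_eq, j_intCast]
  push_cast
  ring

lemma IsCuspRep.row_ne_zero (hr : IsCuspRep Γ a σ r t) (g : SL(2, ℤ)) :
    (t * (r⁻¹ * g) 1 0 : ℝ) ≠ 0 ∨ (t * (r⁻¹ * g) 1 1 : ℝ) ≠ 0 := by
  refine (bottom_row_ne_zero (r⁻¹ * g)).imp ?_ ?_ <;>
  exact fun h => mul_ne_zero hr.ne_zero (Int.cast_ne_zero.2 h)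

lemma mockEisensteinSeries_eq (hr : IsCuspRep Γ a σ r t) (z : ℍ) :
    mockEisensteinSeries Γ k ν a σ z = weightedSum k (fun q : Cosets Γ a => coeff k ν σ q.out)
      (fun q => t * (r⁻¹ * (q.out : SL(2, ℤ))) 1 0) (fun q => t * (r⁻¹ * (q.out : SL(2, ℤ))) 1 1) z := by
  rw [mockEisensteinSeries, nonholEisensteinSeries, weightedSum, powSum, div_eq_inv_mul,
    ofReal_mul, mul_assoc]
  simp only [eisTerm_mul_norm_rpow]
  simp only [powTerm, hr.j_eq_affine, coe_im]

lemma eisensteinSeries_eq (hr : IsCuspRep Γ a σ r t) (z : ℍ) :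
    eisensteinSeries Γ k (fun γ => conj (ν γ)) a σ z =
      conj (powSum (fun q : Cosets Γ a => coeff k ν σ q.out)
      (fun q => t * (r⁻¹ * (q.out : SL(2, ℤ))) 1 0) (fun q => t * (r⁻¹ * (q.out : SL(2, ℤ))) 1 1)
      0 (-k) z) := by
  rw [eisensteinSeries, powSum, conj_tsum]
  simp only [eisTerm_conj, powTerm, hr.j_eq_affine]

lemma locallySummable_coeff (hν : IsMultiplierSystem Γ (2 - k) ν) (hr : IsCuspRep Γ a σ r t)
    (hk : 2 < k) : LocallySummable (fun q : Cosets Γ a => coeff k ν σ q.out)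
      (fun q => t * (r⁻¹ * (q.out : SL(2, ℤ))) 1 0)
      (fun q => t * (r⁻¹ * (q.out : SL(2, ℤ))) 1 1) (-k) :=
  hr.distinctRows.locallySummable hk fun q => (norm_coeff hν σ q.out).le

lemma smooth_mockEisensteinSeries (hν : IsMultiplierSystem Γ (2 - k) ν) (hk : 2 < k)
    (h : IsSingularCusp Γ (2 - k) ν a σ) : Smooth (mockEisensteinSeries Γ k ν a σ) := by
  obtain ⟨r, t, hr⟩ := h.exists_isCuspRep
  exact .of_eq (mockEisensteinSeries_eq hr)
    (contDiffOn_weightedSum (fun q => hr.row_ne_zero _) (locallySummable_coeff hν hr hk))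

lemma laplacian_mockEisensteinSeries (hν : IsMultiplierSystem Γ (2 - k) ν) (hk : 2 < k)
    (h : IsSingularCusp Γ (2 - k) ν a σ) (z : ℍ) :
    laplacian (2 - k) (mockEisensteinSeries Γ k ν a σ) z = 0 := by
  obtain ⟨r, t, hr⟩ := h.exists_isCuspRep
  exact laplacian_eq_zero (fun q => hr.row_ne_zero _) (locallySummable_coeff hν hr hk)
    (smooth_mockEisensteinSeries hν hk h) (dbar_weightedSum (by linarith)
    (fun q => hr.row_ne_zero _) (locallySummable_coeff hν hr hk) (mockEisensteinSeries_eq hr)) z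

lemma shadow_mockEisensteinSeries (hν : IsMultiplierSystem Γ (2 - k) ν) (hk : 2 < k)
    (h : IsSingularCusp Γ (2 - k) ν a σ) : shadow (2 - k) (mockEisensteinSeries Γ k ν a σ) =
      eisensteinSeries Γ k (fun γ => conj (ν γ)) a σ := by
  obtain ⟨r, t, hr⟩ := h.exists_isCuspRep
  ext z
  rw [shadow, dbar, dbar_weightedSum (k := k) (by linarith)
    (fun q => hr.row_ne_zero _) (locallySummable_coeff hν hr hk) (mockEisensteinSeries_eq hr),
    eisensteinSeries_eq hr]
  have h1 : ((z.im ^ (2 - k) : ℝ) : ℂ) * ((z.im ^ (k - 2) : ℝ) : ℂ) = 1 := by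
    rw [← ofReal_mul, ← Real.rpow_add z.im_pos]
    simp
  simp only [map_mul, conj_I, conj_ofReal, map_div₀, map_one, map_ofNat]
  linear_combination (-Complex.I ^ 2 * conj (powSum (fun q : Cosets Γ a => coeff k ν σ q.out)
      (fun q => t * (r⁻¹ * (q.out : SL(2, ℤ))) 1 0) (fun q => t * (r⁻¹ * (q.out : SL(2, ℤ))) 1 1)
      0 (-k) z)) * h1 - conj (powSum (fun q : Cosets Γ a => coeff k ν σ q.out)
      (fun q => t * (r⁻¹ * (q.out : SL(2, ℤ))) 1 0) (fun q => t * (r⁻¹ * (q.out : SL(2, ℤ))) 1 1)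
      0 (-k) z) * Complex.I_sq

end Series

/-! ### Modularity and growth -/

lemma im_smul_eq (g : SL(2, ℝ)) (z : ℍ) : (g • z).im = z.im / ‖j g z‖ ^ 2 := by
  rw [← normSq_eq_norm_sq]
  refine (UpperHalfPlane.im_smul_eq_div_normSq (g : GL (Fin 2) ℝ) z).trans ?_
  simp
  rfl

lemma norm_cpow_ofReal {x : ℂ} (hx : x ≠ 0) (s : ℝ) : ‖x ^ (s : ℂ)‖ = ‖x‖ ^ s := by
  rw [norm_cpow_of_ne_zero hx]
  simp

/-- Right translation by `γ` on `Γ_𝔞 \ Γ`. -/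
def cosetsMulRight {Γ : Subgroup SL(2, ℤ)} (a : OnePoint ℝ) (γ : Γ) : Cosets Γ a ≃ Cosets Γ a :=
  Quotient.congr (Equiv.mulRight γ) fun x y => by
    rw [QuotientGroup.rightRel_apply, QuotientGroup.rightRel_apply]
    simp

variable {Γ : Subgroup SL(2, ℤ)} {k : ℝ} {ν : Γ → ℂ} {a : OnePoint ℝ} {σ : SL(2, ℝ)}

/-- Reindexing by right translation a sum over `Γ_𝔞 \ Γ`. -/
lemma tsum_cosets_mul_right {T : Γ → ℂ} (hT : ∀ δ ∈ stab Γ a, ∀ γ, T (δ * γ) = T γ) (γ : Γ) :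
    ∑' q : Cosets Γ a, T (q.out * γ) = ∑' q : Cosets Γ a, T q.out := by
  rw [← (cosetsMulRight a γ).tsum_eq fun q => T q.out]
  refine tsum_congr fun q => ?_
  have h1 : cosetsMulRight a γ q = ⟦q.out * γ⟧ := by
    conv_lhs => rw [← Quotient.out_eq q]
    rfl
  have h2 : QuotientGroup.rightRel (stab Γ a) (q.out * γ) (cosetsMulRight a γ q).out := by
    refine Quotient.exact ?_
    rw [Quotient.out_eq, h1]
  rw [QuotientGroup.rightRel_apply] at h2
  rw [← hT _ h2 (q.out * γ), inv_mul_cancel_right]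

lemma eisTerm_smul {κ : ℝ} (hν : IsMultiplierSystem Γ κ ν) (δ γ : Γ) (z : ℍ) :
    eisTerm κ ν σ δ (((γ : SL(2, ℤ)) : SL(2, ℝ)) • z) =
      ν γ * j ((γ : SL(2, ℤ)) : SL(2, ℝ)) z ^ (κ : ℂ) * eisTerm κ ν σ (δ * γ) z := by
  rw [eisTerm_eq hν, eisTerm_eq hν, hν.map_mul δ γ z, w, cpow_neg]
  have e0 : ∀ g z, j g z ^ (κ : ℂ) ≠ 0 := fun g z h0 => j_ne_zero g z ((cpow_eq_zero_iff _ _).1 h0).1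
  have e1 : ∀ γ, ν γ ≠ 0 := fun γ h0 => by simpa [h0] using hν.norm_eq_one γ
  have h1 := e0 (((δ : SL(2, ℤ)) : SL(2, ℝ)) * ((γ : SL(2, ℤ)) : SL(2, ℝ))) z
  have h2 := e0 ((γ : SL(2, ℤ)) : SL(2, ℝ)) z
  have h3 := e1 γ
  simp only [Subgroup.coe_mul, map_mul, mul_smul]
  field_simp

lemma slash_mockEisensteinSeries (hν : IsMultiplierSystem Γ (2 - k) ν)
    (h : IsSingularCusp Γ (2 - k) ν a σ) (γ : Γ) (z : ℍ) :
    slash (2 - k) (mockEisensteinSeries Γ k ν a σ) ((γ : SL(2, ℤ)) : SL(2, ℝ)) z =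
      ν γ * mockEisensteinSeries Γ k ν a σ z := by
  obtain ⟨r, t, hr⟩ := h.exists_isCuspRep
  set g : SL(2, ℝ) := ((γ : SL(2, ℤ)) : SL(2, ℝ)) with hg
  have hj := norm_pos_iff.2 (j_ne_zero g z)
  -- An element of the stabilizer, conjugated by r, fixes ∞ and so changes j only by a sign.
  have hnorm : ∀ δ ∈ stab Γ a, ∀ γ : Γ, ‖j (σ⁻¹ * (((δ * γ : Γ) : SL(2, ℤ)) : SL(2, ℝ))) z‖ =
      ‖j (σ⁻¹ * ((γ : SL(2, ℤ)) : SL(2, ℝ))) z‖ := fun δ hδ γ => by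
    obtain ⟨ε, hε, hε'⟩ := exists_sign_of_mem_stabInfty ((hr.mem_stab δ).1 hδ)
    have : r⁻¹ * ((δ * γ : Γ) : SL(2, ℤ)) = (r⁻¹ * δ * r) * (r⁻¹ * γ) := by
      rw [Subgroup.coe_mul]; group
    rw [hr.j_eq, hr.j_eq, this, j_mul_intCast, hε', norm_mul, norm_mul, norm_mul]
    rcases hε with rfl | rfl <;> simp
  have hT : ∀ δ ∈ stab Γ a, ∀ γ : Γ, eisTerm (2 - k) ν σ (δ * γ) z *
      (‖j (σ⁻¹ * (((δ * γ : Γ) : SL(2, ℤ)) : SL(2, ℝ))) z‖ : ℂ) ^ (-2 * ((k - 1 : ℝ) : ℂ)) =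
      eisTerm (2 - k) ν σ γ z *
      (‖j (σ⁻¹ * ((γ : SL(2, ℤ)) : SL(2, ℝ))) z‖ : ℂ) ^ (-2 * ((k - 1 : ℝ) : ℂ)) :=
    fun δ hδ γ => by rw [eisTerm_mul hν h.isSingular hδ, hnorm δ hδ]
  have hN : ∀ δ : Γ, (‖j (σ⁻¹ * ((δ : SL(2, ℤ)) : SL(2, ℝ))) (g • z)‖ : ℂ) ^
      (-2 * ((k - 1 : ℝ) : ℂ)) = ((‖j g z‖ ^ (2 * (k - 1)) : ℝ) : ℂ) *
        (‖j (σ⁻¹ * (((δ * γ : Γ) : SL(2, ℤ)) : SL(2, ℝ))) z‖ : ℂ) ^ (-2 * ((k - 1 : ℝ) : ℂ)) :=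
    fun δ => by
    have e : (-2 * ((k - 1 : ℝ) : ℂ)) = ((-2 * (k - 1) : ℝ) : ℂ) := by push_cast; ring
    have e2 : σ⁻¹ * (((δ * γ : Γ) : SL(2, ℤ)) : SL(2, ℝ)) =
      (σ⁻¹ * ((δ : SL(2, ℤ)) : SL(2, ℝ))) * g := by
      rw [Subgroup.coe_mul, map_mul, mul_assoc]
    rw [e, ← ofReal_cpow (norm_nonneg _), ← ofReal_cpow (norm_nonneg _), ← ofReal_mul, e2]
    generalize σ⁻¹ * ((δ : SL(2, ℤ)) : SL(2, ℝ)) = s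
    rw [j_mul, norm_mul, Real.mul_rpow (norm_nonneg _) (norm_nonneg _), mul_left_comm, ← Real.rpow_add hj]
    simp
  have him : (g • z).im ^ (k - 1) * ‖j g z‖ ^ (2 * (k - 1)) = z.im ^ (k - 1) := by
    rw [im_smul_eq, Real.rpow_mul hj.le, Real.rpow_two, ← Real.mul_rpow (by positivity)
      (by positivity), div_mul_cancel₀ _ (by positivity)]
  have hcp : j g z ^ (-((2 - k : ℝ) : ℂ)) * j g z ^ ((2 - k : ℝ) : ℂ) = 1 := by
    rw [← cpow_add _ _ (j_ne_zero g z)]; simp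
  rw [slash, mockEisensteinSeries, mockEisensteinSeries, nonholEisensteinSeries,
    nonholEisensteinSeries, ← tsum_cosets_mul_right (T := fun γ => eisTerm (2 - k) ν σ γ z *
      (‖j (σ⁻¹ * ((γ : SL(2, ℤ)) : SL(2, ℝ))) z‖ : ℂ) ^ (-2 * ((k - 1 : ℝ) : ℂ))) hT γ]
  simp only [hN]
  simp only [hg, eisTerm_smul hν]
  rw [← hg]
  have : ∀ q : Cosets Γ a, ν γ * j g z ^ ((2 - k : ℝ) : ℂ) * eisTerm (2 - k) ν σ (q.out * γ) z *
      (((‖j g z‖ ^ (2 * (k - 1)) : ℝ) : ℂ) *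
        (‖j (σ⁻¹ * (((q.out * γ : Γ) : SL(2, ℤ)) : SL(2, ℝ))) z‖ : ℂ) ^ (-2 * ((k - 1 : ℝ) : ℂ))) =
      (ν γ * j g z ^ ((2 - k : ℝ) : ℂ) * ((‖j g z‖ ^ (2 * (k - 1)) : ℝ) : ℂ)) *
      (eisTerm (2 - k) ν σ (q.out * γ) z *
        (‖j (σ⁻¹ * (((q.out * γ : Γ) : SL(2, ℤ)) : SL(2, ℝ))) z‖ : ℂ) ^ (-2 * ((k - 1 : ℝ) : ℂ))) :=
    fun q => by ring
  simp only [this]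
  rw [tsum_mul_left, ← him]
  generalize (∑' q : Cosets Γ a, _ : ℂ) = S
  push_cast at hcp ⊢
  linear_combination (((g • z).im ^ (k - 1) : ℝ) : ℂ) / (k - 1) * ν γ *
    ((‖j g z‖ ^ (2 * (k - 1)) : ℝ) : ℂ) * S * hcp

/-- The powers of |j(γ, z)| from the slash, from Im(γz) ^ (k-1) and from the terms cancel, leaving y
^ (k-1) times a sum over the translated rows, which is bounded uniformly in γ. -/
lemma exists_norm_slash_mockEisensteinSeries_le (hν : IsMultiplierSystem Γ (2 - k) ν) (hk : 2 < k)
    (h : IsSingularCusp Γ (2 - k) ν a σ) : ∃ C : ℝ, ∀ (γ : SL(2, ℤ)) (z : ℍ), 1 ≤ z.im →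
      ‖slash (2 - k) (mockEisensteinSeries Γ k ν a σ) (γ : SL(2, ℝ)) z‖ ≤ C * z.im ^ (k - 1) := by
  obtain ⟨r, t, hr⟩ := h.exists_isCuspRep
  obtain ⟨C, hC⟩ := exists_tsum_norm_j_le hk
  refine ⟨(k - 1)⁻¹ * |t| ^ (-k) * C, fun γ z hz => ?_⟩
  set g : SL(2, ℝ) := (γ : SL(2, ℝ)) with hg
  have hj := norm_pos_iff.2 (j_ne_zero g z)
  set α := fun q : Cosets Γ a => coeff k ν σ q.out with hα
  set c : Cosets Γ a → ℝ := fun q => t * (r⁻¹ * (q.out : SL(2, ℤ))) 1 0 with hc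
  set d : Cosets Γ a → ℝ := fun q => t * (r⁻¹ * (q.out : SL(2, ℤ))) 1 1 with hd
  have h0 : ∀ q, c q ≠ 0 ∨ d q ≠ 0 := fun q => hr.row_ne_zero _
  have hterm : ∀ q, ‖powTerm α c d (-1) (1 - k) q (g • z : ℍ)‖ = |t| ^ (-k) * ‖j g z‖ ^ k *
        ‖j ((r⁻¹ * (q.out : SL(2, ℤ)) * γ : SL(2, ℤ)) : SL(2, ℝ)) z‖ ^ (-k) := fun q => by
    rw [norm_powTerm (h0 q) _ _ (g • z).im_pos, norm_coeff hν, one_mul,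
      ← hr.j_eq_affine, hr.j_eq, j_mul_intCast _ γ, norm_mul, norm_mul, norm_real, Real.norm_eq_abs,
      show -1 + (1 - k) = -k by ring, Real.mul_rpow (abs_nonneg _) (norm_nonneg _),
      Real.mul_rpow (norm_nonneg _) (norm_nonneg _), mul_assoc, mul_left_comm (‖j g z‖ ^ k),
      ← Real.rpow_add hj]
    simp [hg]
  have hs : Summable fun q => ‖powTerm α c d (-1) (1 - k) q (g • z : ℍ)‖ :=
    ((locallySummable_coeff hν hr hk).summable h0 (by ring) (g • z).im_pos).norm
  have h1 : ‖powSum α c d (-1) (1 - k) (g • z : ℍ)‖ ≤ |t| ^ (-k) * ‖j g z‖ ^ k * C := by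
    refine (norm_tsum_le_tsum_norm hs).trans ?_
    simp only [hterm]
    rw [tsum_mul_left]
    gcongr
    exact hC (hr.distinctRows.mul_right γ) z hz
  have hk1 : 0 < k - 1 := by linarith
  rw [slash, mockEisensteinSeries_eq hr, weightedSum, norm_mul, norm_mul, norm_mul, ← ofReal_neg,
    norm_cpow_ofReal (j_ne_zero g z), norm_real, norm_real, Real.norm_of_nonneg (by positivity),
    coe_im, im_smul_eq, Real.norm_of_nonneg (by positivity)]
  have h2 : ‖j g z‖ ^ (-(2 - k)) * (z.im / ‖j g z‖ ^ 2) ^ (k - 1) * ‖j g z‖ ^ k = z.im ^ (k - 1) := by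
    rw [Real.div_rpow z.im_pos.le (by positivity), ← Real.rpow_two, ← Real.rpow_mul hj.le,
      div_eq_mul_inv, ← Real.rpow_neg hj.le, mul_left_comm, mul_assoc, mul_assoc,
      ← Real.rpow_add hj, ← Real.rpow_add hj]
    ring_nf
    simp
  calc _ ≤ ‖j g z‖ ^ (-(2 - k)) * ((k - 1)⁻¹ * ((z.im / ‖j g z‖ ^ 2) ^ (k - 1) *
        (|t| ^ (-k) * ‖j g z‖ ^ k * C))) := by gcongr
    _ = (k - 1)⁻¹ * |t| ^ (-k) * C *
        (‖j g z‖ ^ (-(2 - k)) * (z.im / ‖j g z‖ ^ 2) ^ (k - 1) * ‖j g z‖ ^ k) := by ring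
    _ = _ := by rw [h2]

lemma isHarmonicMaassForm_mockEisensteinSeries (hν : IsMultiplierSystem Γ (2 - k) ν) (hk : 2 < k)
    (h : IsSingularCusp Γ (2 - k) ν a σ) :
    IsHarmonicMaassForm Γ (2 - k) ν (mockEisensteinSeries Γ k ν a σ) where
  smooth := smooth_mockEisensteinSeries hν hk h
  slash_eq γ := funext (slash_mockEisensteinSeries hν h γ)
  harmonic := laplacian_mockEisensteinSeries hν hk h
  growth γ := by
    obtain ⟨C, hC⟩ := exists_norm_slash_mockEisensteinSeries_le hν hk h
    refine ⟨1, one_pos, ?_⟩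
    have him : Tendsto UpperHalfPlane.im atImInfty atTop := tendsto_comap
    have h1 : slash (2 - k) (mockEisensteinSeries Γ k ν a σ) (γ : SL(2, ℝ)) =O[atImInfty]
        fun z : ℍ => z.im ^ (k - 1) := by
      refine Asymptotics.IsBigO.of_bound C ?_
      filter_upwards [him.eventually_ge_atTop 1] with z hz
      rw [Real.norm_of_nonneg (Real.rpow_nonneg z.im_pos.le _)]
      exact hC γ z hz
    exact h1.trans ((isLittleO_rpow_exp_pos_mul_atTop (k - 1) one_pos).isBigO.comp_tendsto him)

/-! ### Closure of harmonic Maass forms under linear combinations -/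

section Linearity

variable {κ : ℝ} {f g : ℍ → ℂ}

lemma slash_add (f g : ℍ → ℂ) (γ : SL(2, ℝ)) :
    slash κ (f + g) γ = slash κ f γ + slash κ g γ := by
  ext z; simp [slash, mul_add]

lemma slash_smul (c : ℂ) (f : ℍ → ℂ) (γ : SL(2, ℝ)) :
    slash κ (c • f) γ = c • slash κ f γ := by
  ext z; simp [slash]; ring

lemma IsHarmonicMaassForm.add (hf : IsHarmonicMaassForm Γ κ ν f)
    (hg : IsHarmonicMaassForm Γ κ ν g) : IsHarmonicMaassForm Γ κ ν (f + g) where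
  smooth := hf.smooth.add hg.smooth
  slash_eq γ := by
    rw [slash_add, hf.slash_eq, hg.slash_eq]
    ext z
    simp [mul_add]
  harmonic z := by rw [laplacian_add κ hf.smooth hg.smooth, hf.harmonic, hg.harmonic, add_zero]
  growth γ := by
    obtain ⟨ε, hε, h1⟩ := hf.growth γ
    obtain ⟨δ, hδ, h2⟩ := hg.growth γ
    have key : ∀ {ε δ : ℝ}, ε ≤ δ → (fun z : ℍ => Real.exp (ε * z.im)) =O[atImInfty]
        fun z : ℍ => Real.exp (δ * z.im) := fun h =>
      .of_norm_le fun z => by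
        rw [Real.norm_of_nonneg (Real.exp_pos _).le]
        exact Real.exp_le_exp.2 (mul_le_mul_of_nonneg_right h z.im_pos.le)
    refine ⟨max ε δ, lt_max_of_lt_left hε, ?_⟩
    rw [slash_add]
    exact (h1.trans (key (le_max_left _ _))).add (h2.trans (key (le_max_right _ _)))

lemma IsHarmonicMaassForm.smul (c : ℂ) (hf : IsHarmonicMaassForm Γ κ ν f) :
    IsHarmonicMaassForm Γ κ ν (c • f) where
  smooth := contDiffOn_const.mul hf.smooth
  slash_eq γ := by
    rw [slash_smul, hf.slash_eq]
    ext z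
    simp [mul_left_comm]
  harmonic z := by rw [laplacian_smul κ hf.smooth, hf.harmonic, mul_zero]
  growth γ := by
    obtain ⟨ε, hε, h1⟩ := hf.growth γ
    refine ⟨ε, hε, ?_⟩
    rw [slash_smul]
    exact h1.const_smul_left c

lemma isHarmonicMaassForm_zero : IsHarmonicMaassForm Γ κ ν 0 where
  smooth := contDiffOn_const
  slash_eq γ := by ext z; simp [slash]
  harmonic z := by
    have h : laplacian κ ((0 : ℂ) • (0 : ℍ → ℂ)) z = 0 * laplacian κ 0 z :=
      laplacian_smul κ contDiffOn_const 0 z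
    simpa using h
  growth γ := by
    refine ⟨1, one_pos, ?_⟩
    have : slash κ 0 (γ : SL(2, ℝ)) = fun _ => 0 := by ext z; simp [slash]
    rw [this]
    exact Asymptotics.isBigO_zero _ _

lemma isHarmonicMaassForm_of_mem (hν : IsMultiplierSystem Γ (2 - k) ν) (hk : 2 < k)
    (hf : f ∈ mockEisensteinSpace Γ k ν) : IsHarmonicMaassForm Γ (2 - k) ν f := by
  induction hf using Submodule.span_induction with
  | mem f hf =>
    obtain ⟨a, σ, h, rfl⟩ := hf
    exact isHarmonicMaassForm_mockEisensteinSeries hν hk h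
  | zero => exact isHarmonicMaassForm_zero
  | add f g _ _ hf hg => exact hf.add hg
  | smul c f _ hf => exact hf.smul c

end Linearity

/-! ### Linear independence of the directions of an Eisenstein series -/

lemma j_neg (h : SL(2, ℝ)) (z : ℍ) : j (-h) z = -j h z := by
  simp [j]; ring

lemma cpow_ofReal_mul {x : ℂ} (hx : x ≠ 0) {τ : ℝ} (hτ : 0 < τ) (s : ℂ) :
    (τ * x : ℂ) ^ s = (τ : ℂ) ^ s * x ^ s := by
  have hτ' : (τ : ℂ) ≠ 0 := ofReal_ne_zero.2 hτ.ne'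
  rw [cpow_def_of_ne_zero (mul_ne_zero hτ' hx), Complex.log_ofReal_mul hτ hx,
    cpow_def_of_ne_zero hτ', cpow_def_of_ne_zero hx, ← Complex.exp_add, ← Complex.ofReal_log hτ.le,
    add_mul]

/-- Powers of real multiples of `j(h, z)` are proportional to each other. -/
lemma exists_cpow_ofReal_mul_j (h : SL(2, ℝ)) {τ : ℝ} (hτ : τ ≠ 0) (s : ℝ) :
    ∃ K : ℂ, ∀ z, (τ * j h z : ℂ) ^ (s : ℂ) = K * j h z ^ (s : ℂ) := by
  rcases hτ.lt_or_gt with hneg | hpos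
  -- For τ < 0 write τ j(h) = (-τ) j(-h). The passage from j(-h) ^ s to j(h) ^ s costs the cocycle
  -- w(-1, h), which is constant in z.
  · refine ⟨((-τ : ℝ) : ℂ) ^ (s : ℂ) * (w (-s) (-1) h UpperHalfPlane.I * (-1 : ℂ) ^ (s : ℂ)),
      fun z => ?_⟩
    have h1 : j (-1) (h • z) = -1 := by simp [j]
    have h2 : ∀ {x : ℂ}, x ≠ 0 → x ^ (s : ℂ) ≠ 0 := fun hx h0 => hx ((cpow_eq_zero_iff _ _).1 h0).1
    have h3 := h2 (j_ne_zero h z)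
    have h4 : (-1 : ℂ) ^ (s : ℂ) ≠ 0 := h2 (by simp)
    rw [w_eq_w _ _ _ _ z, w, h1, neg_one_mul h, show -(((-s : ℝ)) : ℂ) = s by simp, ofReal_neg s, cpow_neg, cpow_neg,
      show (τ * j h z : ℂ) = ((-τ : ℝ) : ℂ) * j (-h) z by rw [j_neg]; push_cast; ring,
      cpow_ofReal_mul (j_ne_zero _ _) (neg_pos.2 hneg)]
    field_simp
  · exact ⟨(τ : ℂ) ^ (s : ℂ), fun z => cpow_ofReal_mul (j_ne_zero _ _) hpos _⟩

/-- The point `i y` of the upper half-plane. -/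
def imagPoint (y : ℝ) (hy : 0 < y) : ℍ := ⟨y * Complex.I, by simpa using hy⟩

lemma norm_j_imagPoint_mono (h : SL(2, ℝ)) {x y : ℝ} (hx : 0 < x) (hxy : x ≤ y) :
    ‖j h (imagPoint x hx)‖ ≤ ‖j h (imagPoint y (hx.trans_le hxy))‖ := by
  have e : ∀ y hy, ‖j h (imagPoint y hy)‖ = √((h 1 1) ^ 2 + (h 1 0 * y) ^ 2) := fun y hy => by
    rw [← Complex.norm_add_mul_I]
    simp only [j, imagPoint]
    congr 1
    push_cast
    ring
  rw [e, e]
  apply Real.sqrt_le_sqrt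
  rw [mul_pow, mul_pow]
  gcongr

lemma tendsto_norm_j_imagPoint {h : SL(2, ℝ)} (hc : h 1 0 ≠ 0) :
    Tendsto (fun y : Set.Ici (1 : ℝ) => ‖j h (imagPoint y (one_pos.trans_le y.2))‖)
      atTop atTop := by
  have h1 : Tendsto (fun y : Set.Ici (1 : ℝ) => |h 1 0| * (y : ℝ)) atTop atTop :=
    (tendsto_Ici_atTop.1 tendsto_id).const_mul_atTop (abs_pos.2 hc)
  refine tendsto_atTop_mono (fun y => ?_) h1
  have := abs_mul_im_le_norm_affine (h 1 0) (h 1 1)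
    (imagPoint y (one_pos.trans_le y.2)).im_pos
  simpa [imagPoint, j] using this

section Directions

variable {ι : Type} {h : ι → SL(2, ℤ)} {τ : ι → ℝ} {β : ι → ℂ} {k : ℝ}

/-- Terms in the direction of h0 are constant multiples of j(h0, z) ^ (-k). After division by this
power, all other terms tend to zero as z approaches h0⁻¹∞ along a geodesic, so the sum of the
constants is the limit of zero. -/
lemma tsum_direction_eq_zero (hk : 0 < k) (hτ : ∀ i, τ i ≠ 0)
    (hs : ∀ z, Summable fun i => ‖β i‖ * ‖(τ i * j (h i : SL(2, ℝ)) z : ℂ)‖ ^ (-k))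
    (hsum : ∀ z, ∑' i, β i * (τ i * j (h i : SL(2, ℝ)) z : ℂ) ^ ((-k : ℝ) : ℂ) = 0)
    (h0 : SL(2, ℤ)) (z : ℍ) :
    ∑' i : {i | h i * h0⁻¹ ∈ stabInfty},
      β i * (τ i * j (h i : SL(2, ℝ)) z : ℂ) ^ ((-k : ℝ) : ℂ) = 0 := by
  have hK : ∀ i, ∃ K : ℂ, h i * h0⁻¹ ∈ stabInfty → ∀ z,
      (τ i * j (h i : SL(2, ℝ)) z : ℂ) ^ ((-k : ℝ) : ℂ) =
        K * j (h0 : SL(2, ℝ)) z ^ ((-k : ℝ) : ℂ) := fun i => by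
    by_cases hi : h i * h0⁻¹ ∈ stabInfty
    · obtain ⟨ε, hε, hε'⟩ := exists_sign_of_mem_stabInfty hi
      obtain ⟨K, hK⟩ := exists_cpow_ofReal_mul_j (h0 : SL(2, ℝ)) (τ := τ i * ε)
        (mul_ne_zero (hτ i) (by rcases hε with rfl | rfl <;> simp)) (-k)
      refine ⟨K, fun _ z => ?_⟩
      rw [← hK z]
      have : h i = h i * h0⁻¹ * h0 := by group
      rw [this, j_mul_intCast, hε']
      push_cast
      rw [mul_assoc]
    · exact ⟨0, fun h => absurd h hi⟩
  choose K hK using hK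
  set S : Set ι := {i | h i * h0⁻¹ ∈ stabInfty} with hS
  set P : Set.Ici (1 : ℝ) → ℍ := fun y => imagPoint y (one_pos.trans_le y.2) with hP
  -- The path h0⁻¹(iy), y ≥ 1, runs to the cusp h0⁻¹∞. Along it |j(h, ·)| / |j(h0, ·)| equals |j(h
  -- h0⁻¹, iy)|, which increases in y, so the value at y = 1 dominates.
  set Z : Set.Ici (1 : ℝ) → ℍ := fun y => ((h0⁻¹ : SL(2, ℤ)) : SL(2, ℝ)) • P y with hZ
  have hjZ : ∀ (y) (g : SL(2, ℤ)), j (g : SL(2, ℝ)) (Z y) =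
      j ((g * h0⁻¹ : SL(2, ℤ)) : SL(2, ℝ)) (P y) * j (h0 : SL(2, ℝ)) (Z y) := fun y g => by
    have h1 : j (h0 : SL(2, ℝ)) (Z y) * j ((h0⁻¹ : SL(2, ℤ)) : SL(2, ℝ)) (P y) = 1 := by
      rw [← j_mul_intCast, mul_inv_cancel]
      simp [j]
    rw [j_mul_intCast, mul_assoc, mul_comm (j ((h0⁻¹ : SL(2, ℤ)) : SL(2, ℝ)) (P y)), h1, mul_one]
  have hnorm : ∀ y i, ‖(τ i * j (h i : SL(2, ℝ)) (Z y) : ℂ) ^ ((-k : ℝ) : ℂ) *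
      j (h0 : SL(2, ℝ)) (Z y) ^ (k : ℂ)‖ =
      |τ i| ^ (-k) * ‖j ((h i * h0⁻¹ : SL(2, ℤ)) : SL(2, ℝ)) (P y)‖ ^ (-k) := fun y i => by
    have hj := norm_pos_iff.2 (j_ne_zero (h0 : SL(2, ℝ)) (Z y))
    rw [norm_mul, norm_cpow_ofReal (mul_ne_zero (ofReal_ne_zero.2 (hτ i)) (j_ne_zero _ _)),
      norm_cpow_ofReal (j_ne_zero _ _), hjZ y (h i), norm_mul, norm_mul, norm_real,
      Real.norm_eq_abs, Real.mul_rpow (abs_nonneg _) (by positivity),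
      Real.mul_rpow (norm_nonneg _) (norm_nonneg _), mul_assoc, mul_assoc, ← Real.rpow_add hj,
      neg_add_cancel, Real.rpow_zero, mul_one]
  set F : Set.Ici (1 : ℝ) → ι → ℂ := fun y i => β i *
    ((τ i * j (h i : SL(2, ℝ)) (Z y) : ℂ) ^ ((-k : ℝ) : ℂ) * j (h0 : SL(2, ℝ)) (Z y) ^ (k : ℂ))
    with hF
  have hF0 : ∀ y, ∑' i, F y i = 0 := fun y => by
    simp only [hF, ← mul_assoc]
    rw [tsum_mul_right, hsum, zero_mul]
  set y₁ : Set.Ici (1 : ℝ) := ⟨1, Set.mem_Ici.2 le_rfl⟩ with hy₁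
  have hbound : Summable fun i => ‖F y₁ i‖ := by
    refine ((hs (Z y₁)).mul_right (‖j (h0 : SL(2, ℝ)) (Z y₁)‖ ^ k)).congr fun i => ?_
    symm
    rw [hF]
    simp only
    rw [norm_mul, norm_mul, norm_cpow_ofReal (mul_ne_zero (ofReal_ne_zero.2 (hτ i))
      (j_ne_zero _ _)), norm_cpow_ofReal (j_ne_zero _ _), mul_assoc]
  have hdom : ∀ y i, ‖F y i‖ ≤ ‖F y₁ i‖ := fun y i => by
    simp only [hF]
    rw [norm_mul, norm_mul (β i), hnorm, hnorm]
    refine mul_le_mul_of_nonneg_left (mul_le_mul_of_nonneg_left ?_ (by positivity))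
      (norm_nonneg _)
    refine Real.rpow_le_rpow_of_nonpos (norm_pos_iff.2 (j_ne_zero _ _)) ?_ (by linarith)
    exact norm_j_imagPoint_mono _ one_pos y.2
  have hlim : ∀ i, Tendsto (fun y => F y i) atTop (𝓝 (S.indicator (fun i => β i * K i) i)) := by
    intro i
    by_cases hi : i ∈ S
    · rw [Set.indicator_of_mem hi]
      refine tendsto_const_nhds.congr fun y => ?_
      simp only [hF]
      rw [hK i hi, mul_assoc (K i), ← cpow_add _ _ (j_ne_zero _ _)]
      simp
    · rw [Set.indicator_of_notMem hi, tendsto_zero_iff_norm_tendsto_zero]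
      simp only [hF, norm_mul (β i), hnorm]
      have hc : ((h i * h0⁻¹ : SL(2, ℤ)) : SL(2, ℝ)) 1 0 ≠ 0 := by
        intro h1
        refine hi (mem_stabInfty.2 ?_)
        exact Int.cast_eq_zero (α := ℝ).1 h1
      have := ((tendsto_rpow_neg_atTop hk).comp (tendsto_norm_j_imagPoint hc)).const_mul
        (|τ i| ^ (-k)) |>.const_mul ‖β i‖
      simpa using this
  have key : Tendsto (fun y => ∑' i, F y i) atTop (𝓝 (∑' i, S.indicator (fun i => β i * K i) i)) :=
    tendsto_tsum_of_dominated_convergence hbound hlim (.of_forall hdom)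
  simp only [hF0] at key
  have hzero := tendsto_nhds_unique key tendsto_const_nhds
  rw [← tsum_subtype] at hzero
  have : ∀ i : S, β i * (τ i * j (h i : SL(2, ℝ)) z : ℂ) ^ ((-k : ℝ) : ℂ) =
      β i * K i * j (h0 : SL(2, ℝ)) z ^ ((-k : ℝ) : ℂ) := fun i => by
    rw [hK i i.2, mul_assoc]
  rw [tsum_congr this, tsum_mul_right, hzero, zero_mul]

/-- conj j / j takes the same value at all members of one direction, since they differ by a sign.
Summing direction by direction, it factors out of a sum already known to vanish. -/
lemma tsum_conj_mul_div_eq_zero (hk : 0 < k) (hτ : ∀ i, τ i ≠ 0)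
    (hs : ∀ z, Summable fun i => ‖β i‖ * ‖(τ i * j (h i : SL(2, ℝ)) z : ℂ)‖ ^ (-k))
    (hsum : ∀ z, ∑' i, β i * (τ i * j (h i : SL(2, ℝ)) z : ℂ) ^ ((-k : ℝ) : ℂ) = 0) (z : ℍ) :
    ∑' i, conj (β i * (τ i * j (h i : SL(2, ℝ)) z : ℂ) ^ ((-k : ℝ) : ℂ)) *
      (conj (j (h i : SL(2, ℝ)) z) / j (h i : SL(2, ℝ)) z) = 0 := by
  set f : ι → ℂ := fun i => conj (β i * (τ i * j (h i : SL(2, ℝ)) z : ℂ) ^ ((-k : ℝ) : ℂ)) *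
      (conj (j (h i : SL(2, ℝ)) z) / j (h i : SL(2, ℝ)) z) with hf
  have hfs : Summable f := by
    refine Summable.of_norm ((hs z).congr fun i => ?_)
    have hj := norm_pos_iff.2 (j_ne_zero (h i : SL(2, ℝ)) z)
    symm
    rw [hf]
    simp only
    rw [norm_mul, RCLike.norm_conj, norm_mul, norm_div, RCLike.norm_conj, div_self hj.ne', mul_one,
      norm_cpow_ofReal (mul_ne_zero (ofReal_ne_zero.2 (hτ i)) (j_ne_zero _ _))]
  set δ : ι → Quotient (QuotientGroup.rightRel stabInfty) := fun i => ⟦h i⟧ with hδ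
  rw [← (hfs.hasSum.tsum_fiberwise δ).tsum_eq]
  refine (tsum_congr fun c => ?_).trans tsum_zero
  obtain ⟨h0, rfl⟩ := Quotient.exists_rep c
  have hset : δ ⁻¹' {⟦h0⟧} = {i | h i * h0⁻¹ ∈ stabInfty} := by
    ext i
    rw [Set.mem_preimage, Set.mem_singleton_iff, hδ, Set.mem_ofPred_eq,
      ← QuotientGroup.rightRel_apply]
    exact ⟨fun h => (Quotient.exact h.symm), fun h => (Quotient.sound h).symm⟩
  rw [hset]
  have : ∀ i : {i | h i * h0⁻¹ ∈ stabInfty}, f i =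
      conj (β i * (τ i * j (h i : SL(2, ℝ)) z : ℂ) ^ ((-k : ℝ) : ℂ)) *
      (conj (j (h0 : SL(2, ℝ)) z) / j (h0 : SL(2, ℝ)) z) := fun i => by
    obtain ⟨ε, hε, hε'⟩ := exists_sign_of_mem_stabInfty i.2
    have e : h i = h i * h0⁻¹ * h0 := by group
    have e2 : j (h i : SL(2, ℝ)) z = ε * j (h0 : SL(2, ℝ)) z := by
      rw [e, j_mul_intCast, hε']
    simp only [hf]
    congr 1
    rw [e2]
    rcases hε with rfl | rfl <;> simp
  rw [tsum_congr this, tsum_mul_right, ← conj_tsum,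
    tsum_direction_eq_zero hk hτ hs hsum h0 z]
  simp

end Directions

/-! ### The shadow operator on the span of the mock Eisenstein series -/

section Shadow

variable {Γ : Subgroup SL(2, ℤ)} {k : ℝ} {ν : Γ → ℂ}

/-- All cusps are merged into one family indexed by pairs of a cusp and a coset. Equivalent or
repeated cusps may contribute to the same direction, which the grouping by direction allows. -/
lemma sum_mockEisensteinSeries_eq_zero (hν : IsMultiplierSystem Γ (2 - k) ν) (hk : 2 < k) {n : ℕ}
    {l : Fin n → ℂ} {a : Fin n → OnePoint ℝ} {σ : Fin n → SL(2, ℝ)}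
    (h : ∀ i, IsSingularCusp Γ (2 - k) ν (a i) (σ i))
    (H : ∀ z, ∑ i, conj (l i) * eisensteinSeries Γ k (fun γ => conj (ν γ)) (a i) (σ i) z = 0)
    (z : ℍ) : ∑ i, l i * mockEisensteinSeries Γ k ν (a i) (σ i) z = 0 := by
  choose r t hr using fun i => (h i).exists_isCuspRep
  set g : (Σ i, Cosets Γ (a i)) → SL(2, ℤ) := fun x => (r x.1)⁻¹ * (x.2.out : SL(2, ℤ)) with hg
  set τ : (Σ i, Cosets Γ (a i)) → ℝ := fun x => t x.1 with hτ
  set β : (Σ i, Cosets Γ (a i)) → ℂ := fun x => conj (l x.1) * conj (coeff k ν (σ x.1) x.2.out)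
    with hβ
  have hβn : ∀ x, ‖β x‖ = ‖l x.1‖ := fun x => by
    rw [hβ]
    simp only
    rw [norm_mul, RCLike.norm_conj, RCLike.norm_conj, norm_coeff hν, mul_one]
  have hJ : ∀ x z, (τ x * j (g x : SL(2, ℝ)) z : ℂ) =
      j ((σ x.1)⁻¹ * ((x.2.out : SL(2, ℤ)) : SL(2, ℝ))) z := fun x z => ((hr x.1).j_eq _ z).symm
  have hτ0 : ∀ x, τ x ≠ 0 := fun x => (hr x.1).ne_zero
  replace hβ : ∀ x, β x = conj (l x.1) * conj (coeff k ν (σ x.1) x.2.out) := fun _ => rfl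
  clear_value β τ g
  have hs : ∀ z, Summable fun x => ‖β x‖ * ‖(τ x * j (g x : SL(2, ℝ)) z : ℂ)‖ ^ (-k) := fun z => by
    refine (summable_sigma_of_nonneg fun x => by positivity).2 ⟨fun i => ?_, .of_finite⟩
    refine ((locallySummable_coeff hν (hr i) hk).summable_norm z.im_pos).mul_left ‖l i‖ |>.congr
      fun q => ?_
    rw [hβn, norm_coeff hν, one_mul, hJ, (hr i).j_eq_affine]
  have hs' : ∀ z, Summable fun x => β x * (τ x * j (g x : SL(2, ℝ)) z : ℂ) ^ ((-k : ℝ) : ℂ) :=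
    fun z => .of_norm <| (hs z).congr fun x => by
      rw [norm_mul (β x), hJ, norm_cpow_ofReal (j_ne_zero _ _)]
  have hE : ∀ x z, β x * (τ x * j (g x : SL(2, ℝ)) z : ℂ) ^ ((-k : ℝ) : ℂ) =
      conj (l x.1) * eisTerm k (fun γ => conj (ν γ)) (σ x.1) x.2.out z := fun x z => by
    rw [eisTerm_conj, hJ, hβ]
    simp [mul_assoc]
  have hsum : ∀ z, ∑' x, β x * (τ x * j (g x : SL(2, ℝ)) z : ℂ) ^ ((-k : ℝ) : ℂ) = 0 := fun z => by
    rw [← H z, (hs' z).tsum_sigma, tsum_fintype]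
    refine Finset.sum_congr rfl fun i _ => ?_
    simp only [hE]
    rw [tsum_mul_left, eisensteinSeries]
  have key := tsum_conj_mul_div_eq_zero (by linarith) hτ0 hs hsum z
  -- A mock term is the conjugate weight k term times conj J / J; the real scalar τ drops out of
  -- this quotient.
  have hM : ∀ x, conj (β x * (τ x * j (g x : SL(2, ℝ)) z : ℂ) ^ ((-k : ℝ) : ℂ)) *
      (conj (j (g x : SL(2, ℝ)) z) / j (g x : SL(2, ℝ)) z) =
      l x.1 * (eisTerm (2 - k) ν (σ x.1) x.2.out z *
      (‖j ((σ x.1)⁻¹ * ((x.2.out : SL(2, ℤ)) : SL(2, ℝ))) z‖ : ℂ) ^ (-2 * ((k - 1 : ℝ) : ℂ))) :=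
    fun x => by
    have hj := j_ne_zero (g x : SL(2, ℝ)) z
    have ht : (τ x : ℂ) ≠ 0 := ofReal_ne_zero.2 (hτ0 x)
    have h1 : conj (j (g x : SL(2, ℝ)) z) / j (g x : SL(2, ℝ)) z =
        conj (τ x * j (g x : SL(2, ℝ)) z) / (τ x * j (g x : SL(2, ℝ)) z) := by
      rw [map_mul, conj_ofReal, mul_div_mul_left _ _ ht]
    rw [eisTerm_mul_norm_rpow, h1, hJ, hβ]
    have hJ0 := j_ne_zero ((σ x.1)⁻¹ * ((x.2.out : SL(2, ℤ)) : SL(2, ℝ))) z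
    generalize j ((σ x.1)⁻¹ * ((x.2.out : SL(2, ℤ)) : SL(2, ℝ))) z = J at hJ0 ⊢
    have h2 : J ^ ((1 - k : ℝ) : ℂ) = J ^ ((-k : ℝ) : ℂ) * J := by
      rw [show ((1 - k : ℝ) : ℂ) = ((-k : ℝ) : ℂ) + 1 by push_cast; ring, cpow_add _ _ hJ0,
        cpow_one]
    have h3 : J ^ ((-1 : ℝ) : ℂ) = J⁻¹ := by
      rw [ofReal_neg, ofReal_one, cpow_neg_one]
    rw [h2, h3]
    simp only [map_mul, conj_conj]
    ring
  have hsM : Summable fun x : Σ i, Cosets Γ (a i) =>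
      l x.1 * (eisTerm (2 - k) ν (σ x.1) x.2.out z *
      (‖j ((σ x.1)⁻¹ * ((x.2.out : SL(2, ℤ)) : SL(2, ℝ))) z‖ : ℂ) ^ (-2 * ((k - 1 : ℝ) : ℂ))) := by
    refine .of_norm ((hs' z).norm.congr fun x => ?_)
    rw [← hM, norm_mul (conj _), RCLike.norm_conj, norm_div, RCLike.norm_conj,
      div_self (norm_ne_zero_iff.2 (j_ne_zero _ _)), mul_one]
  simp only [hM] at key
  rw [hsM.tsum_sigma, tsum_fintype] at key
  simp only [tsum_mul_left] at key
  have : ∀ i, l i * mockEisensteinSeries Γ k ν (a i) (σ i) z =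
      ((z.im ^ (k - 1) / (k - 1) : ℝ) : ℂ) *
        (l i * nonholEisensteinSeries Γ (2 - k) ν (a i) (σ i) ((k - 1 : ℝ) : ℂ) z) := fun i => by
    rw [mockEisensteinSeries]; ring
  rw [Finset.sum_congr rfl fun i _ => this i, ← Finset.mul_sum]
  exact mul_eq_zero_of_right _ key

lemma shadow_zero (κ : ℝ) : shadow κ 0 = 0 := by
  have := shadow_smul κ (f := 0) contDiffOn_const 0
  rwa [zero_smul, map_zero, zero_smul] at this

lemma eq_zero_of_shadow_eq_zero (hν : IsMultiplierSystem Γ (2 - k) ν) (hk : 2 < k) {f : ℍ → ℂ}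
    (hf : f ∈ mockEisensteinSpace Γ k ν) (h0 : shadow (2 - k) f = 0) : f = 0 := by
  obtain ⟨n, l, m, rfl⟩ := Submodule.mem_span_set'.1 hf
  choose a σ hm using fun i => (m i).2
  have hsm : ∀ i, Smooth (l i • (m i : ℍ → ℂ)) := fun i => by
    rw [(hm i).2]
    exact contDiffOn_const.mul (smooth_mockEisensteinSeries hν hk (hm i).1)
  -- Smoothness is carried along in the induction because the shadow is additive only where the
  -- derivatives exist.
  have hshadow : ∀ s : Finset (Fin n), Smooth (∑ i ∈ s, l i • (m i : ℍ → ℂ)) ∧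
      shadow (2 - k) (∑ i ∈ s, l i • (m i : ℍ → ℂ)) =
      ∑ i ∈ s, conj (l i) • eisensteinSeries Γ k (fun γ => conj (ν γ)) (a i) (σ i) := by
    intro s
    induction s using Finset.induction_on with
    | empty =>
      refine ⟨by rw [Finset.sum_empty]; exact contDiffOn_const, ?_⟩
      rw [Finset.sum_empty, Finset.sum_empty, shadow_zero]
    | insert i s hi ih =>
      rw [Finset.sum_insert hi, Finset.sum_insert hi]
      refine ⟨(hsm i).add ih.1, ?_⟩
      rw [shadow_add _ (hsm i) ih.1, ih.2, (hm i).2,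
        shadow_smul _ (smooth_mockEisensteinSeries hν hk (hm i).1),
        shadow_mockEisensteinSeries hν hk (hm i).1]
  rw [(hshadow _).2] at h0
  ext z
  have := sum_mockEisensteinSeries_eq_zero hν hk (l := l) (fun i => (hm i).1)
    (fun z => by simpa using congrFun h0 z) z
  simpa [(fun i => (hm i).2 : ∀ i, (m i : ℍ → ℂ) = _)] using this

lemma shadow_mem (hν : IsMultiplierSystem Γ (2 - k) ν) (hk : 2 < k) {f : ℍ → ℂ}
    (hf : f ∈ mockEisensteinSpace Γ k ν) :
    shadow (2 - k) f ∈ eisensteinSpace Γ k (fun γ => conj (ν γ)) := by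
  induction hf using Submodule.span_induction with
  | mem f hf =>
    obtain ⟨a, σ, h, rfl⟩ := hf
    rw [shadow_mockEisensteinSeries hν hk h]
    exact Submodule.subset_span ⟨a, σ, (isSingularCusp_conj_iff hν.norm_eq_one).2 h, rfl⟩
  | zero =>
    rw [shadow_zero]
    exact zero_mem _
  | add f g hf' hg' hf hg =>
    rw [shadow_add _ (isHarmonicMaassForm_of_mem hν hk hf').smooth
      (isHarmonicMaassForm_of_mem hν hk hg').smooth]
    exact add_mem hf hg
  | smul c f hf' hf =>
    rw [shadow_smul _ (isHarmonicMaassForm_of_mem hν hk hf').smooth]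
    exact Submodule.smul_mem _ _ hf

/-- The shadow operator on the span of the mock Eisenstein series. -/
def shadowMap (hν : IsMultiplierSystem Γ (2 - k) ν) (hk : 2 < k) :
    mockEisensteinSpace Γ k ν →ₛₗ[starRingEnd ℂ] eisensteinSpace Γ k (fun γ => conj (ν γ)) where
  toFun f := ⟨shadow (2 - k) f, shadow_mem hν hk f.2⟩
  map_add' f g := Subtype.ext (shadow_add _ (isHarmonicMaassForm_of_mem hν hk f.2).smooth
    (isHarmonicMaassForm_of_mem hν hk g.2).smooth)
  map_smul' c f := Subtype.ext (shadow_smul _ (isHarmonicMaassForm_of_mem hν hk f.2).smooth c)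

lemma shadowMap_bijective (hν : IsMultiplierSystem Γ (2 - k) ν) (hk : 2 < k) :
    Function.Bijective (shadowMap hν hk) := by
  constructor
  · rw [injective_iff_map_eq_zero]
    exact fun f hf => Subtype.ext (eq_zero_of_shadow_eq_zero hν hk f.2 (congrArg Subtype.val hf))
  · rintro ⟨g, hg⟩
    suffices ∃ f ∈ mockEisensteinSpace Γ k ν, shadow (2 - k) f = g by
      obtain ⟨f, hf, rfl⟩ := this
      exact ⟨⟨f, hf⟩, rfl⟩
    induction hg using Submodule.span_induction with
    | mem g hg =>
      obtain ⟨a, σ, h, rfl⟩ := hg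
      have h' := (isSingularCusp_conj_iff hν.norm_eq_one).1 h
      exact ⟨_, Submodule.subset_span ⟨a, σ, h', rfl⟩, shadow_mockEisensteinSeries hν hk h'⟩
    | zero => exact ⟨0, zero_mem _, shadow_zero _⟩
    | add g₁ g₂ _ _ h₁ h₂ =>
      obtain ⟨f₁, hf₁, rfl⟩ := h₁
      obtain ⟨f₂, hf₂, rfl⟩ := h₂
      exact ⟨_, add_mem hf₁ hf₂, shadow_add _ (isHarmonicMaassForm_of_mem hν hk hf₁).smooth
        (isHarmonicMaassForm_of_mem hν hk hf₂).smooth⟩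
    | smul c g _ h =>
      obtain ⟨f, hf, rfl⟩ := h
      -- The preimage is scaled by conj c because the shadow is conjugate-linear.
      refine ⟨_, Submodule.smul_mem _ (conj c) hf, ?_⟩
      rw [shadow_smul _ (isHarmonicMaassForm_of_mem hν hk hf).smooth, conj_conj]

end Shadow

end MockEisenstein

end

theorem corollary4p3 (k : ℝ) (hk : ∃ m : ℤ, k = m / 2) (hk' : 5 / 2 ≤ k)
    (Γ : Subgroup SL(2, ℤ)) (hΓ : Γ.FiniteIndex)
    (ν : Γ → ℂ) (hν : MockEisenstein.IsMultiplierSystem Γ (2 - k) ν) :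
    (∀ f ∈ MockEisenstein.mockEisensteinSpace Γ k ν,
      MockEisenstein.IsHarmonicMaassForm Γ (2 - k) ν f) ∧
    ∃ e : MockEisenstein.mockEisensteinSpace Γ k ν ≃ₛₗ[starRingEnd ℂ]
        MockEisenstein.eisensteinSpace Γ k (fun γ => conj (ν γ)),
      ∀ f, (e f : ℍ → ℂ) = MockEisenstein.shadow (2 - k) (f : ℍ → ℂ) := by
  have hk2 : 2 < k := by linarith
  exact ⟨fun f hf => MockEisenstein.isHarmonicMaassForm_of_mem hν hk2 hf,
    LinearEquiv.ofBijective (MockEisenstein.shadowMap hν hk2)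
      (MockEisenstein.shadowMap_bijective hν hk2), fun f => rfl⟩
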